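/- **Theorem (Small loss guarantees optimal entropy dissipation).** Let $T>0$, let $\pi$ be a strictly positive $C^1$ probability density on $\mathbb R^d$, and let $s_t(x)\in\mathbb R^d$, $(t,x)\in[0,T]\times\mathbb R^d$, be any time-dependent vector field, measurable in $x$ and continuous in $t$. Let $(X_t)_{t\in[0,T]}$ be random vectors in $\mathbb R^d$ on a probability space such that, almost surely, $$\frac{\mathrm d X_t}{\mathrm d t}=\nabla\log\pi(X_t)-s_t(X_t)\qquad\text{for all } t\in[0,T],$$ and suppose that the law of $X_t$ has a probability density $f_t$ for every $t\in[0,T]$ (in particular $X_0\sim f_0$), where $(t,x)\mapsto f_t(x)$ is $C^1$ on $[0,T]\times\mathbb R^d$. Set $$\mathrm{KL}(f_t\|\pi)=\mathbb E_{f_t}\log\tfrac{f_t}{\pi},\qquad F(f_t\|\pi)=\mathbb E_{f_t}\Big\|\nabla\log\tfrac{f_t}{\pi}\Big\|^2,\qquad L(s_t,f_t)=\mathbb E_{f_t}\|s_t-\nabla\log f_t\|^2 .$$ Assume that $\log\frac{f_0}{\pi}$ is $f_0$-integrable and that $F(f_t\|\pi)$ and $L(s_t,f_t)$ are finite and continuous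 in $t\in[0,T]$. Then for every $t\in[0,T]$ the relative entropy $\mathrm{KL}(f_t\|\pi)$ is finite and differentiable in $t$ (one-sidedly at the endpoints), the expectation of the inner product below is that of an $f_t$-integrable function, and $$-\frac{\mathrm d}{\mathrm d t}\mathrm{KL}(f_t\|\pi)=F(f_t\|\pi)-\mathbb E_{f_t}\Big\langle \nabla\log f_t-s_t,\ \nabla\log\tfrac{f_t}{\pi}\Big\rangle\ \ge\ \tfrac12F(f_t\|\pi)-\tfrac12L(s_t,f_t).$$ In particular, for every $t\in[0,T]$ with $L(s_t,f_t)\le\frac12F(f_t\|\pi)$, $$-\frac{\mathrm d}{\mathrm d t}\mathrm{KL}(f_t\|\pi)\ge\tfrac14F(f_t\|\pi).$$ -/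

import Mathlib

namespace ScoreDynamics

open MeasureTheory

/-- The measure `p(x) dx` on `ℝᵈ` with Lebesgue density `p`. -/
noncomputable def densMeasure {d : ℕ} (p : EuclideanSpace ℝ (Fin d) → ℝ) :
    Measure (EuclideanSpace ℝ (Fin d)) :=
  (volume : Measure (EuclideanSpace ℝ (Fin d))).withDensity (fun x => ENNReal.ofReal (p x))

/-- `p` is a probability density on `ℝᵈ`. -/
def IsProbDensity {d : ℕ} (p : EuclideanSpace ℝ (Fin d) → ℝ) : Prop :=
  (∀ x, 0 ≤ p x) ∧ Integrable p ∧ ∫ x, p x = 1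

/-- The score `∇ log p`. It is meaningful at points where `p` is positive and differentiable. -/
noncomputable def score {d : ℕ} (p : EuclideanSpace ℝ (Fin d) → ℝ)
    (x : EuclideanSpace ℝ (Fin d)) : EuclideanSpace ℝ (Fin d) :=
  gradient (fun y => Real.log (p y)) x

/-- The relative score `∇ log (f / π)`. -/
noncomputable def relScore {d : ℕ} (f π : EuclideanSpace ℝ (Fin d) → ℝ)
    (x : EuclideanSpace ℝ (Fin d)) : EuclideanSpace ℝ (Fin d) :=
  gradient (fun y => Real.log (f y / π y)) x

/-- The relative entropy `KL(f ‖ π) = E_f [log (f / π)]`. -/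
noncomputable def relEntropy {d : ℕ} (f π : EuclideanSpace ℝ (Fin d) → ℝ) : ℝ :=
  ∫ x, Real.log (f x / π x) ∂(densMeasure f)

/-- The relative Fisher information `F(f ‖ π) = E_f ‖∇ log (f / π)‖²`. -/
noncomputable def relFisher {d : ℕ} (f π : EuclideanSpace ℝ (Fin d) → ℝ) : ℝ :=
  ∫ x, ‖relScore f π x‖ ^ 2 ∂(densMeasure f)

/-- The score-matching loss `L(s, f) = E_f ‖s - ∇ log f‖²`. -/
noncomputable def scoreLoss {d : ℕ} (s : EuclideanSpace ℝ (Fin d) → EuclideanSpace ℝ (Fin d))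
    (f : EuclideanSpace ℝ (Fin d) → ℝ) : ℝ :=
  ∫ x, ‖s x - score f x‖ ^ 2 ∂(densMeasure f)

end ScoreDynamics

/- Write `h = f / π` and `b = ∇ log π - s`, so that `h t` is the density of the law of `X t` with
respect to the measure `π dx`. Testing the law along the trajectories gives the continuity equation
`∂ₜ h + div (h b) = 0` weakly in the weighted space, and formally
`d/dt ∫ h log h = ∫ ⟪∇h, b⟫ = 𝔼 ⟪∇ log f - s, ∇ log (f / π)⟫ - F`, which is the claimed identity;
the inequality is Young's inequality `⟪u, v⟫ ≤ ‖u‖² / 2 + ‖v‖² / 2`.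

To justify the formal computation, test the continuity equation with `χₙ ψ_δ(h)`, where `χₙ` is a
spatial cutoff and `ψ_δ` a smooth bounded truncation of the logarithm with `|y ψ_δ' y| ≤ 1`. Finite
Fisher information and loss make `h b` and `⟪∇h, b⟫` integrable in space-time, so dominated
convergence gives the entropy balance between times `0` and `t` as first `n → ∞` and then `δ → 0`;
Fatou's lemma makes the entropy finite at time `t`. Finally the rate `∫ ⟪∇h, b⟫` is continuous in
time by dominated convergence with dominating functions whose integrals converge, so the integrated
balance can be differentiated. -/

namespace ScoreDynamics

open MeasureTheory Filter Topology Set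

section TruncatedLogarithm

variable {δ y : ℝ}

/-- A bounded substitute for `log` on `[0, ∞)`: the logarithm of `(y + δ) / (1 + δ y)`, which lies
between `1` and `y` and between `δ` and `δ⁻¹`. -/
noncomputable def truncLog (δ y : ℝ) : ℝ :=
  Real.log (y + δ) - Real.log (1 + δ * y)

lemma contDiffAt_truncLog (hδ : 0 < δ) (hy : 0 ≤ y) : ContDiffAt ℝ 1 (truncLog δ) y := by
  unfold truncLog
  have h₁ : y + δ ≠ 0 := by positivity
  have h₂ : 1 + δ * y ≠ 0 := by positivity
  fun_prop (disch := assumption)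

lemma mul_deriv_truncLog (hδ : 0 < δ) (hy : 0 ≤ y) :
    y * deriv (truncLog δ) y = y / (y + δ) - δ * y / (1 + δ * y) := by
  have h₁ : HasDerivAt (fun z => Real.log (z + δ)) (1 / (y + δ)) y :=
    ((hasDerivAt_id y).add_const δ).log (by positivity)
  have h₂ : HasDerivAt (fun z => Real.log (1 + δ * z)) (δ * 1 / (1 + δ * y)) y :=
    (((hasDerivAt_id y).const_mul δ).const_add 1).log (by positivity)
  have h : HasDerivAt (truncLog δ) (1 / (y + δ) - δ * 1 / (1 + δ * y)) y := h₁.sub h₂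
  rw [h.deriv]
  ring

lemma abs_mul_deriv_truncLog_le (hδ : 0 < δ) (hy : 0 ≤ y) :
    |y * deriv (truncLog δ) y| ≤ 1 := by
  have h₁ : y / (y + δ) ≤ 1 := div_le_one_of_le₀ (by linarith) (by positivity)
  have h₂ : δ * y / (1 + δ * y) ≤ 1 := div_le_one_of_le₀ (by linarith) (by positivity)
  have h₃ : 0 ≤ y / (y + δ) := by positivity
  have h₄ : 0 ≤ δ * y / (1 + δ * y) := by positivity
  rw [mul_deriv_truncLog hδ hy, abs_le]
  constructor <;> linarith

lemma abs_truncLog_le (hδ : 0 < δ) (hδ' : δ < 1) (hy : 0 ≤ y) :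
    |truncLog δ y| ≤ -Real.log δ := by
  have hδy : 0 ≤ δ * y := by positivity
  have h₁ : Real.log δ + Real.log (1 + δ * y) ≤ Real.log (y + δ) := by
    rw [← Real.log_mul (by positivity) (by positivity)]
    exact Real.log_le_log (by positivity) (by nlinarith)
  have h₂ : Real.log δ + Real.log (y + δ) ≤ Real.log (1 + δ * y) := by
    rw [← Real.log_mul (by positivity) (by positivity)]
    exact Real.log_le_log (by positivity) (by nlinarith)
  rw [truncLog, abs_le]
  constructor <;> linarith

lemma truncLog_mem_Icc_of_one_le (hδ : 0 < δ) (hδ' : δ < 1) (hy : 1 ≤ y) :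
    truncLog δ y ∈ Icc 0 (Real.log y) := by
  have h₁ : Real.log (1 + δ * y) ≤ Real.log (y + δ) :=
    Real.log_le_log (by positivity) (by nlinarith)
  have h₂ : Real.log (y + δ) ≤ Real.log y + Real.log (1 + δ * y) := by
    rw [← Real.log_mul (by positivity) (by positivity)]
    exact Real.log_le_log (by positivity) (by nlinarith [mul_nonneg hδ.le (sub_nonneg.2 hy)])
  exact ⟨sub_nonneg.2 h₁, sub_le_iff_le_add.2 h₂⟩

lemma truncLog_mem_Icc_of_le_one (hδ : 0 < δ) (hδ' : δ < 1) (hy : 0 < y) (hy' : y ≤ 1) :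
    truncLog δ y ∈ Icc (Real.log y) 0 := by
  have h₁ : Real.log (y + δ) ≤ Real.log (1 + δ * y) :=
    Real.log_le_log (by positivity) (by nlinarith)
  have h₂ : Real.log y + Real.log (1 + δ * y) ≤ Real.log (y + δ) := by
    rw [← Real.log_mul (by positivity) (by positivity)]
    refine Real.log_le_log (by positivity) ?_
    nlinarith [mul_nonneg hδ.le (sub_nonneg.2 hy'),
      mul_nonneg (mul_nonneg hδ.le hy.le) (sub_nonneg.2 hy')]
  exact ⟨le_sub_iff_add_le.2 h₂, sub_nonpos.2 h₁⟩

lemma abs_truncLog_le_abs_log (hδ : 0 < δ) (hδ' : δ < 1) (hy : 0 < y) :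
    |truncLog δ y| ≤ |Real.log y| := by
  rcases le_total 1 y with h | h
  · obtain ⟨h₀, h₁⟩ := truncLog_mem_Icc_of_one_le hδ hδ' h
    exact abs_le_abs_of_nonneg h₀ h₁
  · obtain ⟨h₁, h₀⟩ := truncLog_mem_Icc_of_le_one hδ hδ' hy h
    exact abs_le_abs_of_nonpos h₀ h₁

variable {ι : Type*} {l : Filter ι} {δ : ι → ℝ}

lemma tendsto_truncLog (hδ : Tendsto δ l (𝓝 0)) (hy : 0 < y) :
    Tendsto (fun i => truncLog (δ i) y) l (𝓝 (Real.log y)) := by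
  have h : ContinuousAt (fun ε => truncLog ε y) 0 := by
    unfold truncLog
    fun_prop (disch := simp [hy.ne'])
  simpa [truncLog, Function.comp_def] using h.tendsto.comp hδ

lemma tendsto_mul_deriv_truncLog (hδ : Tendsto δ l (𝓝[>] 0)) (hy : 0 < y) :
    Tendsto (fun i => y * deriv (truncLog (δ i)) y) l (𝓝 1) := by
  have h : ContinuousAt (fun ε => y / (y + ε) - ε * y / (1 + ε * y)) 0 := by
    fun_prop (disch := simp [hy.ne'])
  have hlim := h.tendsto.comp (hδ.mono_right nhdsWithin_le_nhds)
  simp only [add_zero, zero_mul, zero_div, sub_zero, div_self hy.ne'] at hlim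
  refine hlim.congr' ?_
  filter_upwards [hδ self_mem_nhdsWithin] with i hi
  exact (mul_deriv_truncLog hi hy.le).symm

end TruncatedLogarithm

section Primitive

variable {ψ : ℝ → ℝ} {y : ℝ}

lemma intervalIntegrable_of_contDiffAt_nonneg (hψ : ∀ z, 0 ≤ z → ContDiffAt ℝ 1 ψ z) {a b : ℝ}
    (ha : 0 ≤ a) (hb : 0 ≤ b) : IntervalIntegrable ψ volume a b :=
  ContinuousOn.intervalIntegrable fun z hz =>
    (hψ z ((le_inf ha hb).trans hz.1)).continuousAt.continuousWithinAt

lemma hasDerivAt_primitive (hψ : ∀ z, 0 ≤ z → ContDiffAt ℝ 1 ψ z) (hy : 0 ≤ y) :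
    HasDerivAt (fun u => ∫ z in 0..u, ψ z) (ψ y) y := by
  have hmeas : StronglyMeasurableAtFilter ψ (𝓝 y) := by
    obtain ⟨u, hu, hu_open, hyu⟩ := mem_nhds_iff.1 ((hψ y hy).eventually (by simp))
    exact ContinuousAt.stronglyMeasurableAtFilter hu_open
      (fun z hz => ContDiffAt.continuousAt (n := 1) (𝕜 := ℝ) (hu hz)) y hyu
  exact intervalIntegral.integral_hasDerivAt_right
    (intervalIntegrable_of_contDiffAt_nonneg hψ le_rfl hy) hmeas (hψ y hy).continuousAt

lemma abs_primitive_le {C : ℝ} (hψ : ∀ z, 0 ≤ z → |ψ z| ≤ C) (hy : 0 ≤ y) :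
    |∫ z in 0..y, ψ z| ≤ C * y := by
  have := intervalIntegral.norm_integral_le_of_norm_le_const (f := ψ) (a := 0) (b := y) (C := C)
    fun z hz => hψ z (by rw [uIoc_of_le hy] at hz; exact hz.1.le)
  simpa [abs_of_nonneg hy] using this

end Primitive

section TruncatedEntropy

variable {δ y : ℝ}

lemma intervalIntegrable_truncLog (hδ : 0 < δ) {a b : ℝ} (ha : 0 ≤ a) (hb : 0 ≤ b) :
    IntervalIntegrable (truncLog δ) volume a b :=
  intervalIntegrable_of_contDiffAt_nonneg (fun _ => contDiffAt_truncLog hδ) ha hb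

lemma integral_truncLog_mem_Icc_of_le_one (hδ : 0 < δ) (hδ' : δ < 1) (hy : 0 ≤ y) (hy' : y ≤ 1) :
    ∫ z in 0..y, truncLog δ z ∈ Icc (-1) 0 := by
  have hz : ∀ z ∈ Ioo 0 y, truncLog δ z ∈ Icc (Real.log z) 0 := fun z hz =>
    truncLog_mem_Icc_of_le_one hδ hδ' hz.1 (hz.2.le.trans hy')
  have hlog : -1 ≤ ∫ z in 0..y, Real.log z := by
    rw [integral_log]
    have := Real.self_sub_one_le_mul_log hy
    simp only [Real.log_zero, mul_zero, sub_zero, add_zero]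
    linarith
  have hint := intervalIntegrable_truncLog hδ le_rfl hy
  constructor
  · exact hlog.trans <| intervalIntegral.integral_mono_on_of_le_Ioo hy
      intervalIntegral.intervalIntegrable_log' hint fun z h => (hz z h).1
  · simpa using intervalIntegral.integral_mono_on_of_le_Ioo hy hint
      (intervalIntegrable_const (c := (0 : ℝ))) fun z h => (hz z h).2

lemma integral_truncLog_mem_Icc_of_one_le (hδ : 0 < δ) (hδ' : δ < 1) (hy : 1 ≤ y) :
    ∫ z in 1..y, truncLog δ z ∈ Icc 0 (y * Real.log y) := by
  have hz : ∀ z ∈ Icc 1 y, truncLog δ z ∈ Icc 0 (Real.log z) := fun z hz =>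
    truncLog_mem_Icc_of_one_le hδ hδ' hz.1
  refine ⟨intervalIntegral.integral_nonneg hy fun z h => (hz z h).1, ?_⟩
  calc ∫ z in 1..y, truncLog δ z ≤ ∫ z in 1..y, Real.log z :=
        intervalIntegral.integral_mono_on hy
          (intervalIntegrable_truncLog hδ zero_le_one (zero_le_one.trans hy))
          intervalIntegral.intervalIntegrable_log' fun z h => (hz z h).2
    _ ≤ y * Real.log y := by
        rw [integral_log, Real.log_one]
        linarith

lemma integral_truncLog_mem_Icc (hδ : 0 < δ) (hδ' : δ < 1) (hy : 0 ≤ y) :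
    ∫ z in 0..y, truncLog δ z ∈ Icc (-1) |y * Real.log y| := by
  rcases le_total y 1 with h | h
  · obtain ⟨h₁, h₂⟩ := integral_truncLog_mem_Icc_of_le_one hδ hδ' hy h
    exact ⟨h₁, h₂.trans (abs_nonneg _)⟩
  · obtain ⟨h₁, h₂⟩ := integral_truncLog_mem_Icc_of_le_one hδ hδ' zero_le_one le_rfl
    obtain ⟨h₃, h₄⟩ := integral_truncLog_mem_Icc_of_one_le hδ hδ' h
    rw [← intervalIntegral.integral_add_adjacent_intervals
      (intervalIntegrable_truncLog hδ le_rfl zero_le_one)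
      (intervalIntegrable_truncLog hδ zero_le_one hy)]
    exact ⟨by linarith, by linarith [le_abs_self (y * Real.log y)]⟩

lemma tendsto_integral_truncLog {ι : Type*} {l : Filter ι} [l.IsCountablyGenerated] {δ : ι → ℝ}
    (hδ : Tendsto δ l (𝓝[>] 0)) (hy : 0 ≤ y) :
    Tendsto (fun i => ∫ z in 0..y, truncLog (δ i) z) l (𝓝 (y * Real.log y - y)) := by
  have hδ₀ : Tendsto δ l (𝓝 0) := hδ.mono_right nhdsWithin_le_nhds
  have hlim : ∫ z in 0..y, Real.log z = y * Real.log y - y := by simp [integral_log]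
  have hδ_mem : ∀ᶠ i in l, 0 < δ i ∧ δ i < 1 :=
    (hδ.eventually eventually_mem_nhdsWithin).and (hδ₀.eventually_lt_const zero_lt_one)
  rw [← hlim]
  refine intervalIntegral.tendsto_integral_filter_of_dominated_convergence
    (fun z => |Real.log z|) ?_ ?_ intervalIntegral.intervalIntegrable_log'.abs ?_
  · filter_upwards [hδ_mem] with i hi
    simpa only [uIoc_of_le hy] using (intervalIntegrable_truncLog hi.1 le_rfl hy).1.1
  · filter_upwards [hδ_mem] with i hi
    refine ae_of_all _ fun z hz => abs_truncLog_le_abs_log hi.1 hi.2 ?_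
    rw [uIoc_of_le hy] at hz
    exact hz.1
  · refine ae_of_all _ fun z hz => tendsto_truncLog hδ₀ ?_
    rw [uIoc_of_le hy] at hz
    exact hz.1

end TruncatedEntropy

section Regularity

variable {E : Type*} {T t : ℝ} {h : ℝ → E → ℝ}

/-- The time derivative of `h` relative to the interval `[0, T]`, one-sided at the endpoints. -/
noncomputable def timeDeriv (T : ℝ) (h : ℝ → E → ℝ) (t : ℝ) (x : E) : ℝ :=
  derivWithin (fun τ => h τ x) (Icc 0 T) t

lemma timeDeriv_eq_zero {x : E} (hx : ∀ r ∈ Icc 0 T, h r x = 0) (ht : t ∈ Icc 0 T) :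
    timeDeriv T h t x = 0 := by
  rw [timeDeriv, derivWithin_congr (f := fun _ => 0) hx (hx t ht), derivWithin_fun_const]
  rfl

variable [NormedAddCommGroup E] [InnerProductSpace ℝ E]

lemma uniqueDiffOn_Icc_prod_univ (hT : 0 < T) : UniqueDiffOn ℝ (Icc 0 T ×ˢ (univ : Set E)) :=
  (uniqueDiffOn_Icc hT).prod uniqueDiffOn_univ

lemma hasFDerivWithinAt_uncurry (hh : ContDiffOn ℝ 1 (Function.uncurry h) (Icc 0 T ×ˢ univ))
    (ht : t ∈ Icc 0 T) (x : E) :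
    HasFDerivWithinAt (Function.uncurry h)
      (fderivWithin ℝ (Function.uncurry h) (Icc 0 T ×ˢ univ) (t, x)) (Icc 0 T ×ˢ univ) (t, x) :=
  (hh.differentiableOn one_ne_zero (t, x) ⟨ht, trivial⟩).hasFDerivWithinAt

lemma hasFDerivAt_slice (hh : ContDiffOn ℝ 1 (Function.uncurry h) (Icc 0 T ×ˢ univ))
    (ht : t ∈ Icc 0 T) (x : E) :
    HasFDerivAt (h t) ((fderivWithin ℝ (Function.uncurry h) (Icc 0 T ×ˢ univ) (t, x)).comp
      (ContinuousLinearMap.inr ℝ ℝ E)) x :=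
  hasFDerivWithinAt_univ.1 <| (hasFDerivWithinAt_uncurry hh ht x).comp x
    (hasFDerivAt_prodMk_right t x).hasFDerivWithinAt fun _ _ => ⟨ht, trivial⟩

lemma continuous_slice (hh : ContDiffOn ℝ 1 (Function.uncurry h) (Icc 0 T ×ˢ univ))
    (ht : t ∈ Icc 0 T) : Continuous (h t) :=
  continuous_iff_continuousAt.2 fun x => (hasFDerivAt_slice hh ht x).continuousAt

lemma hasDerivWithinAt_curve_fderivWithin
    (hh : ContDiffOn ℝ 1 (Function.uncurry h) (Icc 0 T ×ˢ univ)) (ht : t ∈ Icc 0 T)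
    {Y : ℝ → E} {Y' : E} (hY : HasDerivWithinAt Y Y' (Icc 0 T) t) :
    HasDerivWithinAt (fun τ => h τ (Y τ))
      (fderivWithin ℝ (Function.uncurry h) (Icc 0 T ×ˢ univ) (t, Y t) (1, Y')) (Icc 0 T) t := by
  have hmaps : MapsTo (fun τ => (τ, Y τ)) (Icc 0 T) (Icc 0 T ×ˢ univ) := fun _ hτ => ⟨hτ, trivial⟩
  exact (hasFDerivWithinAt_uncurry hh ht (Y t)).comp_hasDerivWithinAt t
    ((hasDerivWithinAt_id t _).prodMk hY) hmaps

lemma timeDeriv_eq_fderivWithin (hT : 0 < T)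
    (hh : ContDiffOn ℝ 1 (Function.uncurry h) (Icc 0 T ×ˢ univ)) (ht : t ∈ Icc 0 T) (x : E) :
    timeDeriv T h t x = fderivWithin ℝ (Function.uncurry h) (Icc 0 T ×ˢ univ) (t, x) (1, 0) :=
  (hasDerivWithinAt_curve_fderivWithin hh ht (hasDerivWithinAt_const t _ x)).derivWithin
    (uniqueDiffOn_Icc hT t ht)

lemma hasDerivWithinAt_timeDeriv (hh : ContDiffOn ℝ 1 (Function.uncurry h) (Icc 0 T ×ˢ univ))
    (ht : t ∈ Icc 0 T) (x : E) :
    HasDerivWithinAt (fun τ => h τ x) (timeDeriv T h t x) (Icc 0 T) t :=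
  (hasDerivWithinAt_curve_fderivWithin hh ht
    (hasDerivWithinAt_const t _ x)).differentiableWithinAt.hasDerivWithinAt

lemma continuousOn_timeDeriv (hT : 0 < T)
    (hh : ContDiffOn ℝ 1 (Function.uncurry h) (Icc 0 T ×ˢ univ)) :
    ContinuousOn (Function.uncurry (timeDeriv T h)) (Icc 0 T ×ˢ univ) :=
  ((hh.continuousOn_fderivWithin (uniqueDiffOn_Icc_prod_univ hT) le_rfl).clm_apply
    continuousOn_const).congr fun q hq => timeDeriv_eq_fderivWithin hT hh hq.1 q.2

variable [CompleteSpace E]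

lemma continuousOn_gradient (hT : 0 < T)
    (hh : ContDiffOn ℝ 1 (Function.uncurry h) (Icc 0 T ×ˢ univ)) :
    ContinuousOn (fun q : ℝ × E => gradient (h q.1) q.2) (Icc 0 T ×ˢ univ) := by
  have h' := hh.continuousOn_fderivWithin (uniqueDiffOn_Icc_prod_univ hT) le_rfl
  refine ((InnerProductSpace.toDual ℝ E).symm.continuous.comp_continuousOn
    (h'.clm_comp (continuousOn_const (c := ContinuousLinearMap.inr ℝ ℝ E)))).congr fun q hq => ?_
  rw [gradient, (hasFDerivAt_slice hh hq.1 q.2).fderiv]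
  rfl

lemma hasDerivWithinAt_curve (hT : 0 < T)
    (hh : ContDiffOn ℝ 1 (Function.uncurry h) (Icc 0 T ×ˢ univ)) (ht : t ∈ Icc 0 T)
    {Y : ℝ → E} {Y' : E} (hY : HasDerivWithinAt Y Y' (Icc 0 T) t) :
    HasDerivWithinAt (fun τ => h τ (Y τ))
      (timeDeriv T h t (Y t) + inner ℝ (gradient (h t) (Y t)) Y') (Icc 0 T) t := by
  refine (hasDerivWithinAt_curve_fderivWithin hh ht hY).congr_deriv ?_
  have hsplit : ((1 : ℝ), Y') = (1, 0) + ContinuousLinearMap.inr ℝ ℝ E Y' := by simp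
  rw [hsplit, map_add, timeDeriv_eq_fderivWithin hT hh ht, gradient,
    InnerProductSpace.toDual_symm_apply, (hasFDerivAt_slice hh ht (Y t)).fderiv]
  rfl

lemma gradient_eq_zero_of_nonneg {φ : E → ℝ} (hφ : ∀ y, 0 ≤ φ y) {x : E} (hx : φ x = 0) :
    gradient φ x = 0 := by
  have hmin : IsLocalMin φ x := Eventually.of_forall fun y => hx ▸ hφ y
  rw [gradient, hmin.fderiv_eq_zero, map_zero]

lemma gradient_eq_zero_of_notMem {φ : E → ℝ} {K : Set E} (hK : IsClosed K)
    (hφ : ∀ x ∉ K, φ x = 0) {x : E} (hx : x ∉ K) : gradient φ x = 0 := by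
  have hev : φ =ᶠ[𝓝 x] fun _ => 0 := by
    filter_upwards [hK.isOpen_compl.mem_nhds hx] using hφ
  rw [hev.gradient_eq, gradient_fun_const]

lemma gradient_log {φ : E → ℝ} {x : E} (hφ : DifferentiableAt ℝ φ x) (hx : φ x ≠ 0) :
    gradient (fun y => Real.log (φ y)) x = (φ x)⁻¹ • gradient φ x := by
  rw [gradient, fderiv.log hφ hx, map_smul]
  rfl

end Regularity

section Cutoff

variable {E : Type*} [NormedAddCommGroup E] [InnerProductSpace ℝ E]

/-- The smooth cutoffs `x ↦ ρ (x / (n + 1))`, where `ρ` is a bump function equal to `1` on the unit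
ball; they exhaust the space with gradients tending to zero uniformly. -/
noncomputable def cutoff [FiniteDimensional ℝ E] (n : ℕ) (x : E) : ℝ :=
  (⟨1, 2, one_pos, one_lt_two⟩ : ContDiffBump (0 : E)) ((n + 1 : ℝ)⁻¹ • x)

variable [FiniteDimensional ℝ E]

lemma contDiff_cutoff (n : ℕ) : ContDiff ℝ 1 (cutoff (E := E) n) :=
  (ContDiffBump.contDiff _).comp (contDiff_const_smul _)

lemma hasCompactSupport_cutoff (n : ℕ) : HasCompactSupport (cutoff (E := E) n) :=
  (ContDiffBump.hasCompactSupport _).comp_smul (by positivity)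

lemma cutoff_nonneg (n : ℕ) (x : E) : 0 ≤ cutoff n x := ContDiffBump.nonneg _

lemma cutoff_le_one (n : ℕ) (x : E) : cutoff n x ≤ 1 := ContDiffBump.le_one _

lemma abs_cutoff_le_one (n : ℕ) (x : E) : |cutoff n x| ≤ 1 :=
  (abs_of_nonneg (cutoff_nonneg n x)).trans_le (cutoff_le_one n x)

lemma tendsto_cutoff (x : E) : Tendsto (fun n => cutoff n x) atTop (𝓝 1) := by
  refine tendsto_const_nhds.congr' ?_
  filter_upwards [tendsto_natCast_atTop_atTop.eventually_ge_atTop ‖x‖] with n hn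
  refine (ContDiffBump.one_of_mem_closedBall _ ?_).symm
  rw [mem_closedBall_zero_iff, norm_smul, norm_inv, Real.norm_of_nonneg (by positivity),
    inv_mul_le_iff₀ (by positivity), mul_one]
  exact hn.trans (le_add_of_nonneg_right zero_le_one)

lemma exists_norm_gradient_cutoff_le_div :
    ∃ C : ℝ, ∀ (n : ℕ) (x : E), ‖gradient (cutoff n) x‖ ≤ C / (n + 1) := by
  let ρ : ContDiffBump (0 : E) := ⟨1, 2, one_pos, one_lt_two⟩
  have hρ : ContDiff ℝ 1 ρ := ρ.contDiff
  obtain ⟨C, hC⟩ := (ρ.hasCompactSupport.fderiv ℝ).exists_bound_of_continuous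
    (hρ.continuous_fderiv one_ne_zero)
  refine ⟨C, fun n x => ?_⟩
  have hn : (0 : ℝ) < n + 1 := by positivity
  have hfd : fderiv ℝ (cutoff n) x = (n + 1 : ℝ)⁻¹ • fderiv ℝ ρ ((n + 1 : ℝ)⁻¹ • x) :=
    fderiv_comp_smul _
  rw [gradient, LinearIsometryEquiv.norm_map, hfd, norm_smul, norm_inv,
    Real.norm_of_nonneg hn.le, inv_mul_eq_div]
  gcongr
  exact hC _

lemma exists_norm_gradient_cutoff_le : ∃ C : ℝ, ∀ (n : ℕ) (x : E), ‖gradient (cutoff n) x‖ ≤ C := by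
  obtain ⟨C, hC⟩ := exists_norm_gradient_cutoff_le_div (E := E)
  have hC_nonneg : 0 ≤ C := by simpa using (norm_nonneg _).trans (hC 0 0)
  exact ⟨C, fun n x => (hC n x).trans
    (div_le_self hC_nonneg (le_add_of_nonneg_left n.cast_nonneg))⟩

lemma tendsto_gradient_cutoff (x : E) :
    Tendsto (fun n => gradient (cutoff n) x) atTop (𝓝 0) := by
  obtain ⟨C, hC⟩ := exists_norm_gradient_cutoff_le_div (E := E)
  exact squeeze_zero_norm (fun n => hC n x) (tendsto_const_nhds.div_atTop
    (tendsto_natCast_atTop_atTop.atTop_add tendsto_const_nhds))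

end Cutoff

section Limits

variable {α : Type*} [MeasurableSpace α] {μ : Measure α}

lemma lintegral_ofReal_le_of_tendsto {G : ℕ → α → ℝ} {f : α → ℝ} {c : ℝ}
    (hG : ∀ n, Integrable (G n) μ) (hG_nonneg : ∀ n x, 0 ≤ G n x)
    (hlim : ∀ᵐ x ∂μ, f x ≠ 0 → Tendsto (fun n => G n x) atTop (𝓝 (f x)))
    (hc : ∃ᶠ n in atTop, ∫ x, G n x ∂μ ≤ c) :
    ∫⁻ x, ENNReal.ofReal (f x) ∂μ ≤ ENNReal.ofReal c := by
  have hle : ∀ᵐ x ∂μ, ENNReal.ofReal (f x) ≤ liminf (fun n => ENNReal.ofReal (G n x)) atTop := by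
    filter_upwards [hlim] with x hx
    by_cases hfx : f x = 0
    · simp [hfx]
    · exact ((ENNReal.continuous_ofReal.tendsto _).comp (hx hfx)).liminf_eq.ge
  calc ∫⁻ x, ENNReal.ofReal (f x) ∂μ
      ≤ ∫⁻ x, liminf (fun n => ENNReal.ofReal (G n x)) atTop ∂μ := lintegral_mono_ae hle
    _ ≤ liminf (fun n => ∫⁻ x, ENNReal.ofReal (G n x) ∂μ) atTop :=
        lintegral_liminf_le' fun n => (hG n).1.aemeasurable.ennreal_ofReal
    _ ≤ ENNReal.ofReal c := by
        refine liminf_le_of_frequently_le' (hc.mono fun n hn => ?_)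
        rw [← ofReal_integral_eq_lintegral_ofReal (hG n) (ae_of_all _ (hG_nonneg n))]
        exact ENNReal.ofReal_le_ofReal hn

lemma integrable_of_tendsto_of_nonneg {G : ℕ → α → ℝ} {f : α → ℝ} {A : ℝ}
    (hG : ∀ n, Integrable (G n) μ) (hG_nonneg : ∀ n x, 0 ≤ G n x)
    (hlim : ∀ x, Tendsto (fun n => G n x) atTop (𝓝 (f x)))
    (hA : Tendsto (fun n => ∫ x, G n x ∂μ) atTop (𝓝 A)) : Integrable f μ := by
  have hf : AEStronglyMeasurable f μ :=
    aestronglyMeasurable_of_tendsto_ae _ (fun n => (hG n).1) (ae_of_all _ hlim)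
  have hf_nonneg : ∀ x, 0 ≤ f x := fun x => ge_of_tendsto' (hlim x) fun n => hG_nonneg n x
  have hfreq : ∃ᶠ n in atTop, ∫ x, G n x ∂μ ≤ A + 1 :=
    (hA.eventually_le_const (lt_add_one A)).frequently
  exact (lintegral_ofReal_ne_top_iff_integrable hf (ae_of_all _ hf_nonneg)).1
    ((lintegral_ofReal_le_of_tendsto hG hG_nonneg (ae_of_all _ fun x _ => hlim x) hfreq).trans_lt
      ENNReal.ofReal_lt_top).ne

lemma integral_le_of_tendsto_of_nonneg {G : ℕ → α → ℝ} {f : α → ℝ} {c : ℝ}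
    (hG : ∀ n, Integrable (G n) μ) (hG_nonneg : ∀ n x, 0 ≤ G n x)
    (hf : Integrable f μ) (hf_nonneg : ∀ x, 0 ≤ f x)
    (hlim : ∀ᵐ x ∂μ, f x ≠ 0 → Tendsto (fun n => G n x) atTop (𝓝 (f x)))
    (hc : ∃ᶠ n in atTop, ∫ x, G n x ∂μ ≤ c) : ∫ x, f x ∂μ ≤ c := by
  have hc₀ : 0 ≤ c := by
    obtain ⟨n, hn⟩ := hc.exists
    exact (integral_nonneg (hG_nonneg n)).trans hn
  rw [← ENNReal.ofReal_le_ofReal_iff hc₀,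
    ofReal_integral_eq_lintegral_ofReal hf (ae_of_all _ hf_nonneg)]
  exact lintegral_ofReal_le_of_tendsto hG hG_nonneg hlim hc

/- Fatou's lemma for `G n + F n ≥ 0`. -/
lemma eventually_lt_integral_of_abs_le {F G : ℕ → α → ℝ} {F' G' : α → ℝ} {a : ℝ}
    (hF : ∀ n, Integrable (F n) μ) (hF' : Integrable F' μ)
    (hG : ∀ n, Integrable (G n) μ) (hG' : Integrable G' μ)
    (hFG : ∀ n x, |F n x| ≤ G n x) (hFG' : ∀ x, |F' x| ≤ G' x)
    (hF_lim : ∀ᵐ x ∂μ, G' x ≠ 0 → Tendsto (fun n => F n x) atTop (𝓝 (F' x)))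
    (hG_lim : ∀ᵐ x ∂μ, G' x ≠ 0 → Tendsto (fun n => G n x) atTop (𝓝 (G' x)))
    (hG_int : Tendsto (fun n => ∫ x, G n x ∂μ) atTop (𝓝 (∫ x, G' x ∂μ)))
    (ha : a < ∫ x, F' x ∂μ) : ∀ᶠ n in atTop, a < ∫ x, F n x ∂μ := by
  by_contra hcon
  have hfreq : ∃ᶠ n in atTop, ∫ x, F n x ∂μ ≤ a := by simpa [Filter.Frequently] using hcon
  obtain ⟨ε, hε, haε⟩ : ∃ ε > 0, a + ε < ∫ x, F' x ∂μ :=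
    ⟨(∫ x, F' x ∂μ - a) / 2, by linarith, by linarith⟩
  have hle : ∫ x, (F' x + G' x) ∂μ ≤ a + (∫ x, G' x ∂μ + ε) := by
    refine integral_le_of_tendsto_of_nonneg (fun n => (hF n).add (hG n))
      (fun n x => by simpa using neg_le_iff_add_nonneg.1 (abs_le.1 (hFG n x)).1)
      (hF'.add hG') (fun x => by linarith [(abs_le.1 (hFG' x)).1]) ?_ ?_
    · filter_upwards [hF_lim, hG_lim] with x hFx hGx hne
      have hGne : G' x ≠ 0 := fun h0 => hne (by simp [h0, abs_nonpos_iff.1 (h0 ▸ hFG' x)])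
      exact (hFx hGne).add (hGx hGne)
    · refine (hfreq.and_eventually
        (hG_int.eventually_le_const (lt_add_of_pos_right _ hε))).mono fun n hn => ?_
      simpa only [Pi.add_apply, integral_add (hF n) (hG n)] using add_le_add hn.1 hn.2
  rw [integral_add hF' hG'] at hle
  linarith

lemma tendsto_integral_of_abs_le {F G : ℕ → α → ℝ} {F' G' : α → ℝ}
    (hF : ∀ n, Integrable (F n) μ) (hF' : Integrable F' μ)
    (hG : ∀ n, Integrable (G n) μ) (hG' : Integrable G' μ)
    (hFG : ∀ n x, |F n x| ≤ G n x) (hFG' : ∀ x, |F' x| ≤ G' x)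
    (hF_lim : ∀ᵐ x ∂μ, G' x ≠ 0 → Tendsto (fun n => F n x) atTop (𝓝 (F' x)))
    (hG_lim : ∀ᵐ x ∂μ, G' x ≠ 0 → Tendsto (fun n => G n x) atTop (𝓝 (G' x)))
    (hG_int : Tendsto (fun n => ∫ x, G n x ∂μ) atTop (𝓝 (∫ x, G' x ∂μ))) :
    Tendsto (fun n => ∫ x, F n x ∂μ) atTop (𝓝 (∫ x, F' x ∂μ)) := by
  refine tendsto_order.2 ⟨fun a ha =>
    eventually_lt_integral_of_abs_le hF hF' hG hG' hFG hFG' hF_lim hG_lim hG_int ha,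
    fun a ha => ?_⟩
  have hneg : ∀ᶠ n in atTop, -a < ∫ x, -F n x ∂μ :=
    eventually_lt_integral_of_abs_le (fun n => (hF n).neg) hF'.neg hG hG'
      (fun n x => (abs_neg _).trans_le (hFG n x)) (fun x => (abs_neg _).trans_le (hFG' x))
      (hF_lim.mono fun x hx hGx => (hx hGx).neg) hG_lim hG_int
      (by rw [integral_neg']; exact neg_lt_neg ha)
  exact hneg.mono fun n hn => by rwa [integral_neg, neg_lt_neg_iff] at hn

end Limits

section SquareIntegrable

variable {α E : Type*} [MeasurableSpace α] {μ : Measure α} [NormedAddCommGroup E]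
  [InnerProductSpace ℝ E] {u v : α → E}

lemma abs_inner_le_half_norm_sq_add (a c : E) :
    |inner ℝ a c| ≤ (1 / 2) * (‖a‖ ^ 2 + ‖c‖ ^ 2) := by
  nlinarith [abs_real_inner_le_norm a c, sq_nonneg (‖a‖ - ‖c‖)]

lemma integrable_inner_of_norm_sq (hu : AEStronglyMeasurable u μ) (hv : AEStronglyMeasurable v μ)
    (hu_sq : Integrable (fun x => ‖u x‖ ^ 2) μ) (hv_sq : Integrable (fun x => ‖v x‖ ^ 2) μ) :
    Integrable (fun x => inner ℝ (u x) (v x)) μ :=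
  ((hu_sq.add hv_sq).const_mul (1 / 2)).mono' (hu.inner hv)
    (ae_of_all _ fun x => abs_inner_le_half_norm_sq_add (u x) (v x))

lemma integral_inner_le_half_add (hu_sq : Integrable (fun x => ‖u x‖ ^ 2) μ)
    (hv_sq : Integrable (fun x => ‖v x‖ ^ 2) μ)
    (huv : Integrable (fun x => inner ℝ (u x) (v x)) μ) :
    ∫ x, inner ℝ (u x) (v x) ∂μ ≤ (1 / 2) * (∫ x, ‖u x‖ ^ 2 ∂μ + ∫ x, ‖v x‖ ^ 2 ∂μ) := by
  rw [← integral_add hu_sq hv_sq, ← integral_const_mul]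
  exact integral_mono huv ((hu_sq.add hv_sq).const_mul _) fun x =>
    (le_abs_self _).trans (abs_inner_le_half_norm_sq_add (u x) (v x))

end SquareIntegrable

lemma exists_norm_le_of_continuousOn {E G : Type*} [TopologicalSpace E] [NormedAddCommGroup G]
    {T : ℝ} {K : Set E} {F : ℝ × E → G} (hK : IsCompact K)
    (hF : ContinuousOn F (Icc 0 T ×ˢ univ)) (hF_zero : ∀ r ∈ Icc 0 T, ∀ x ∉ K, F (r, x) = 0) :
    ∃ C, ∀ r ∈ Icc 0 T, ∀ x, ‖F (r, x)‖ ≤ C := by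
  obtain ⟨C, hC⟩ := (isCompact_Icc.prod hK).exists_bound_of_continuousOn
    (hF.mono (prod_mono_right (subset_univ K)))
  refine ⟨max C 0, fun r hr x => ?_⟩
  by_cases hx : x ∈ K
  · exact (hC (r, x) ⟨hr, hx⟩).trans (le_max_left _ _)
  · simp [hF_zero r hr x hx]

section SpaceTime

variable {E G : Type*} [MeasurableSpace E] [NormedAddCommGroup G] {m : Measure E} {t T : ℝ}

/-- The product of Lebesgue measure on the time interval `(0, t]` and the measure `m` in space. -/
noncomputable def spaceTime (t : ℝ) (m : Measure E) : Measure (ℝ × E) :=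
  (volume.restrict (Ioc 0 t)).prod m

instance [SFinite m] : SFinite (spaceTime t m) := by unfold spaceTime; infer_instance

instance [IsFiniteMeasure m] : IsFiniteMeasure (spaceTime t m) := by
  unfold spaceTime; infer_instance

lemma spaceTime_mono [SFinite m] (ht : t ≤ T) : spaceTime t m ≤ spaceTime T m :=
  Measure.prod_mono (Measure.restrict_mono (Ioc_subset_Ioc_right ht) le_rfl) le_rfl

lemma spaceTime_eq_restrict [SFinite m] :
    spaceTime t m = (volume.prod m).restrict (Ioc 0 t ×ˢ univ) := by
  rw [spaceTime, ← Measure.prod_restrict, Measure.restrict_univ]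

lemma ae_spaceTime_of_forall [SFinite m] {p : ℝ × E → Prop}
    (hp : ∀ r ∈ Ioc 0 t, ∀ x, p (r, x)) : ∀ᵐ q ∂spaceTime t m, p q := by
  rw [spaceTime_eq_restrict]
  exact ae_restrict_of_forall_mem (measurableSet_Ioc.prod .univ) fun q hq => hp q.1 hq.1 q.2

lemma integral_spaceTime [NormedSpace ℝ G] [SFinite m] (ht : 0 ≤ t) {F : ℝ × E → G}
    (hF : Integrable F (spaceTime t m)) :
    ∫ q, F q ∂spaceTime t m = ∫ r in 0..t, ∫ x, F (r, x) ∂m := by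
  rw [intervalIntegral.integral_of_le ht, spaceTime, integral_prod F hF]

lemma integral_spaceTime_symm [NormedSpace ℝ G] [SFinite m] (ht : 0 ≤ t) {F : ℝ × E → G}
    (hF : Integrable F (spaceTime t m)) :
    ∫ q, F q ∂spaceTime t m = ∫ x, (∫ r in 0..t, F (r, x)) ∂m := by
  simp only [intervalIntegral.integral_of_le ht]
  exact integral_prod_symm F hF

lemma integrable_spaceTime_of_nonneg [SFinite m] {F : ℝ × E → ℝ}
    (hF : AEStronglyMeasurable F (spaceTime T m))
    (hF_nonneg : ∀ r ∈ Ioc 0 T, ∀ x, 0 ≤ F (r, x))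
    (hF_slice : ∀ r ∈ Ioc 0 T, Integrable (fun x => F (r, x)) m)
    (hF_cont : ContinuousOn (fun r => ∫ x, F (r, x) ∂m) (Icc 0 T)) :
    Integrable F (spaceTime T m) := by
  refine (integrable_prod_iff hF).2 ⟨ae_restrict_of_forall_mem measurableSet_Ioc hF_slice, ?_⟩
  refine (hF_cont.integrableOn_Icc.mono_set Ioc_subset_Icc_self).congr_fun (fun r hr => ?_)
    measurableSet_Ioc
  exact integral_congr_ae (ae_of_all _ fun x => (Real.norm_of_nonneg (hF_nonneg r hr x)).symm)

variable [TopologicalSpace E] [SecondCountableTopology E] [BorelSpace E]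

lemma aestronglyMeasurable_spaceTime_of_continuousOn [SFinite m] {F : ℝ × E → G}
    (hF : ContinuousOn F (Icc 0 T ×ˢ univ)) : AEStronglyMeasurable F (spaceTime T m) := by
  rw [spaceTime_eq_restrict]
  exact (hF.mono (prod_mono_left Ioc_subset_Icc_self)).aestronglyMeasurable
    (measurableSet_Ioc.prod .univ)

lemma integrable_spaceTime_of_continuousOn [IsFiniteMeasure m] {K : Set E} {F : ℝ × E → G}
    (hK : IsCompact K) (hF : ContinuousOn F (Icc 0 T ×ˢ univ))
    (hF_zero : ∀ r ∈ Icc 0 T, ∀ x ∉ K, F (r, x) = 0) : Integrable F (spaceTime T m) := by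
  obtain ⟨C, hC⟩ := exists_norm_le_of_continuousOn hK hF hF_zero
  exact .of_bound (aestronglyMeasurable_spaceTime_of_continuousOn hF) C
    (ae_spaceTime_of_forall fun r hr => hC r (Ioc_subset_Icc_self hr))

end SpaceTime

lemma integral_eq_sub_of_hasDerivWithinAt_Icc {G : Type*} [NormedAddCommGroup G] [NormedSpace ℝ G]
    [CompleteSpace G] {g g' : ℝ → G} {t T : ℝ} (ht : t ∈ Icc 0 T)
    (hg : ∀ r ∈ Icc 0 T, HasDerivWithinAt g (g' r) (Icc 0 T) r)
    (hg' : IntervalIntegrable g' volume 0 t) : ∫ r in 0..t, g' r = g t - g 0 := by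
  refine intervalIntegral.integral_eq_sub_of_hasDerivAt_of_le ht.1
    (fun r hr => (hg r ⟨hr.1, hr.2.trans ht.2⟩).continuousWithinAt.mono (Icc_subset_Icc_right ht.2))
    (fun r hr => ?_) hg'
  have hr' : r ∈ Ioo 0 T := ⟨hr.1, hr.2.trans_le ht.2⟩
  exact (hg r (Ioo_subset_Icc_self hr')).hasDerivAt (Icc_mem_nhds hr'.1 hr'.2)

lemma integral_timeDeriv_add_inner_gradient_curve {E : Type*} [NormedAddCommGroup E]
    [InnerProductSpace ℝ E] [CompleteSpace E] {φ : ℝ → E → ℝ} {Y Y' : ℝ → E} {t T : ℝ} (hT : 0 < T)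
    (hφ : ContDiffOn ℝ 1 (Function.uncurry φ) (Icc 0 T ×ˢ univ)) (ht : t ∈ Icc 0 T)
    (hY : ∀ r ∈ Icc 0 T, HasDerivWithinAt Y (Y' r) (Icc 0 T) r)
    (hint : IntegrableOn
      (fun r => timeDeriv T φ r (Y r) + inner ℝ (gradient (φ r) (Y r)) (Y' r)) (Ioc 0 t)) :
    ∫ r in 0..t, (timeDeriv T φ r (Y r) + inner ℝ (gradient (φ r) (Y r)) (Y' r)) =
      φ t (Y t) - φ 0 (Y 0) :=
  integral_eq_sub_of_hasDerivWithinAt_Icc ht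
    (fun r hr => hasDerivWithinAt_curve hT hφ hr (hY r hr))
    ((intervalIntegrable_iff_integrableOn_Ioc_of_le ht.1).2 hint)

section ContinuityFlow

variable {E : Type*} [NormedAddCommGroup E] [InnerProductSpace ℝ E]

/-- A `C¹` test function on `[0, T] × E` whose support in space lies in one compact set for all
times. -/
structure IsTestFunction (T : ℝ) (φ : ℝ → E → ℝ) : Prop where
  contDiffOn : ContDiffOn ℝ 1 (Function.uncurry φ) (Icc 0 T ×ˢ univ)
  exists_isCompact : ∃ K, IsCompact K ∧ ∀ t ∈ Icc 0 T, ∀ x ∉ K, φ t x = 0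

variable [MeasurableSpace E]

namespace IsTestFunction

variable {T t : ℝ} {φ : ℝ → E → ℝ} [BorelSpace E] {m : Measure E}

lemma integrable_mul [IsFiniteMeasureOnCompacts m] (hφ : IsTestFunction T φ) (ht : t ∈ Icc 0 T)
    {u : E → ℝ} (hu : Continuous u) : Integrable (fun x => φ t x * u x) m := by
  obtain ⟨K, hK, hφK⟩ := hφ.exists_isCompact
  exact ((continuous_slice hφ.contDiffOn ht).mul hu).integrable_of_hasCompactSupport
    (HasCompactSupport.intro hK (hφK t ht)).mul_right

variable [FiniteDimensional ℝ E] [IsFiniteMeasure m]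

lemma integrable_inner_gradient (hφ : IsTestFunction T φ) (hT : 0 < T) {J : ℝ × E → E}
    (hJ : Integrable J (spaceTime T m)) :
    Integrable (fun q : ℝ × E => inner ℝ (gradient (φ q.1) q.2) (J q)) (spaceTime T m) := by
  obtain ⟨K, hK, hφK⟩ := hφ.exists_isCompact
  have hgrad := continuousOn_gradient hT hφ.contDiffOn
  obtain ⟨C, hC⟩ := exists_norm_le_of_continuousOn hK hgrad
    fun r hr x hx => gradient_eq_zero_of_notMem hK.isClosed (hφK r hr) hx
  refine (hJ.norm.const_mul C).mono'
    ((aestronglyMeasurable_spaceTime_of_continuousOn hgrad).inner hJ.1)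
    (ae_spaceTime_of_forall fun r hr x => (norm_inner_le_norm _ _).trans ?_)
  gcongr
  exact hC r (Ioc_subset_Icc_self hr) x

lemma integrable_timeDeriv_mul (hφ : IsTestFunction T φ) (hT : 0 < T) {h : ℝ → E → ℝ}
    (hh : ContinuousOn (Function.uncurry h) (Icc 0 T ×ˢ univ)) :
    Integrable (fun q : ℝ × E => timeDeriv T φ q.1 q.2 * h q.1 q.2) (spaceTime T m) := by
  obtain ⟨K, hK, hφK⟩ := hφ.exists_isCompact
  exact integrable_spaceTime_of_continuousOn hK ((continuousOn_timeDeriv hT hφ.contDiffOn).mul hh)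
    fun r hr x hx => by
      rw [timeDeriv_eq_zero (fun r hr => hφK r hr x hx) hr, zero_mul]

end IsTestFunction

variable [FiniteDimensional ℝ E]

/-- The curve of measures `h t • m` is transported by the velocity field `b` on `[0, T]`: its `C¹`
density `h` is nonnegative, has constant mass, and solves the continuity equation
`∂ₜ (h m) + div (h b m) = 0` in the weak sense. -/
structure IsContinuityFlow (T : ℝ) (m : Measure E) (h : ℝ → E → ℝ) (b : ℝ → E → E) : Prop where
  time_pos : 0 < T
  nonneg : ∀ t ∈ Icc 0 T, ∀ x, 0 ≤ h t x
  contDiffOn : ContDiffOn ℝ 1 (Function.uncurry h) (Icc 0 T ×ˢ univ)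
  integrable : ∀ t ∈ Icc 0 T, Integrable (h t) m
  integral_eq : ∀ t ∈ Icc 0 T, ∫ x, h t x ∂m = ∫ x, h 0 x ∂m
  integrable_current : Integrable (fun q : ℝ × E => h q.1 q.2 • b q.1 q.2) (spaceTime T m)
  weak_eq : ∀ φ, IsTestFunction T φ → ∀ t ∈ Icc 0 T,
    ∫ x, φ t x * h t x ∂m - ∫ x, φ 0 x * h 0 x ∂m =
      ∫ q, (timeDeriv T φ q.1 q.2 * h q.1 q.2
        + inner ℝ (gradient (φ q.1) q.2) (h q.1 q.2 • b q.1 q.2)) ∂spaceTime t m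

end ContinuityFlow

section Renormalization

variable {E : Type*} [NormedAddCommGroup E] [InnerProductSpace ℝ E] {ψ : ℝ → ℝ}

lemma continuousOn_deriv_of_contDiffAt_nonneg (hψ : ∀ y, 0 ≤ y → ContDiffAt ℝ 1 ψ y) :
    ContinuousOn (deriv ψ) (Ici 0) := fun y hy => by
  have h := (hψ y hy).fderiv_right (m := 0) le_rfl
  exact (h.continuousAt.clm_apply continuousAt_const).continuousWithinAt

lemma continuousOn_primitive (hψ : ∀ y, 0 ≤ y → ContDiffAt ℝ 1 ψ y) :
    ContinuousOn (fun u => ∫ z in 0..u, ψ z) (Ici 0) := fun _ hu =>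
  (hasDerivAt_primitive hψ hu).continuousAt.continuousWithinAt

lemma continuousOn_mul_of_contDiffAt_nonneg (hψ : ∀ y, 0 ≤ y → ContDiffAt ℝ 1 ψ y) :
    ContinuousOn (fun u => u * ψ u) (Ici 0) :=
  continuousOn_id.mul fun u hu => (hψ u hu).continuousAt.continuousWithinAt

lemma hasDerivAt_mul_sub_primitive (hψ : ∀ y, 0 ≤ y → ContDiffAt ℝ 1 ψ y) {y : ℝ} (hy : 0 ≤ y) :
    HasDerivAt (fun u => u * ψ u - ∫ z in 0..u, ψ z) (y * deriv ψ y) y := by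
  have hψ' : HasDerivAt ψ (deriv ψ y) y := ((hψ y hy).differentiableAt one_ne_zero).hasDerivAt
  exact (((hasDerivAt_id y).mul hψ').sub (hasDerivAt_primitive hψ hy)).congr_deriv (by simp)

lemma gradient_mul_comp [CompleteSpace E] {χ u : E → ℝ} {x : E} (hχ : DifferentiableAt ℝ χ x)
    (hψ : DifferentiableAt ℝ ψ (u x)) (hu : DifferentiableAt ℝ u x) :
    gradient (fun y => χ y * ψ (u y)) x =
      ψ (u x) • gradient χ x + (χ x * deriv ψ (u x)) • gradient u x := by
  have h := hχ.hasFDerivAt.mul (hψ.hasDerivAt.comp_hasFDerivAt x hu.hasFDerivAt)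
  rw [gradient, HasFDerivAt.fderiv (f := fun y => χ y * ψ (u y)) h, map_add, map_smul, map_smul,
    map_smul, smul_smul, add_comm]
  rfl

lemma inner_gradient_mul_comp [CompleteSpace E] {χ u : E → ℝ} {x : E}
    (hχ : DifferentiableAt ℝ χ x) (hψ : DifferentiableAt ℝ ψ (u x))
    (hu : DifferentiableAt ℝ u x) (v : E) :
    inner ℝ (gradient (fun y => χ y * ψ (u y)) x) (u x • v) =
      ψ (u x) * inner ℝ (gradient χ x) (u x • v)
        + χ x * (u x * deriv ψ (u x) * inner ℝ (gradient u x) v) := by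
  rw [gradient_mul_comp hχ hψ hu]
  simp only [inner_add_left, real_inner_smul_left, real_inner_smul_right]
  ring

variable {T t : ℝ} {h : ℝ → E → ℝ} {χ : E → ℝ}

lemma isTestFunction_mul_comp (hh : ContDiffOn ℝ 1 (Function.uncurry h) (Icc 0 T ×ˢ univ))
    (hh_nonneg : ∀ t ∈ Icc 0 T, ∀ x, 0 ≤ h t x) (hψ : ∀ y, 0 ≤ y → ContDiffAt ℝ 1 ψ y)
    (hχ : ContDiff ℝ 1 χ) (hχ' : HasCompactSupport χ) :
    IsTestFunction T (fun t x => χ x * ψ (h t x)) where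
  contDiffOn := fun q hq => ((hχ.comp contDiff_snd).contDiffAt.contDiffWithinAt).mul
    ((hψ _ (hh_nonneg q.1 hq.1 q.2)).comp_contDiffWithinAt q (hh q hq))
  exists_isCompact :=
    ⟨tsupport χ, hχ', fun t _ x hx => by simp [image_eq_zero_of_notMem_tsupport hx]⟩

lemma timeDeriv_mul_comp (hT : 0 < T)
    (hh : ContDiffOn ℝ 1 (Function.uncurry h) (Icc 0 T ×ˢ univ)) (ht : t ∈ Icc 0 T) {x : E}
    (hψ : DifferentiableAt ℝ ψ (h t x)) :
    timeDeriv T (fun t x => χ x * ψ (h t x)) t x =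
      χ x * (deriv ψ (h t x) * timeDeriv T h t x) :=
  ((hψ.hasDerivAt.comp_hasDerivWithinAt t
    (hasDerivWithinAt_timeDeriv hh ht x)).const_mul (χ x)).derivWithin (uniqueDiffOn_Icc hT t ht)

lemma continuousOn_mul_deriv_mul_timeDeriv (hT : 0 < T)
    (hh : ContDiffOn ℝ 1 (Function.uncurry h) (Icc 0 T ×ˢ univ))
    (hh_nonneg : ∀ t ∈ Icc 0 T, ∀ x, 0 ≤ h t x) (hψ : ∀ y, 0 ≤ y → ContDiffAt ℝ 1 ψ y) :
    ContinuousOn (fun q : ℝ × E => h q.1 q.2 * deriv ψ (h q.1 q.2) * timeDeriv T h q.1 q.2)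
      (Icc 0 T ×ˢ univ) := by
  have hψh : ContinuousOn (fun q : ℝ × E => deriv ψ (h q.1 q.2)) (Icc 0 T ×ˢ univ) :=
    (continuousOn_deriv_of_contDiffAt_nonneg hψ).comp hh.continuousOn
      fun q hq => hh_nonneg q.1 hq.1 q.2
  exact (hh.continuousOn.mul hψh).mul (continuousOn_timeDeriv hT hh)

variable [FiniteDimensional ℝ E] [MeasurableSpace E] [BorelSpace E] {m : Measure E}
  {b : ℝ → E → E}

namespace IsContinuityFlow

lemma integrable_timeDeriv_part [IsFiniteMeasure m] (hflow : IsContinuityFlow T m h b)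
    (hψ : ∀ y, 0 ≤ y → ContDiffAt ℝ 1 ψ y) (hχ : Continuous χ) (hχ' : HasCompactSupport χ) :
    Integrable (fun q : ℝ × E =>
      χ q.2 * (h q.1 q.2 * deriv ψ (h q.1 q.2) * timeDeriv T h q.1 q.2)) (spaceTime T m) :=
  integrable_spaceTime_of_continuousOn hχ'.isCompact
    ((hχ.comp continuous_snd).continuousOn.mul (continuousOn_mul_deriv_mul_timeDeriv
      hflow.time_pos hflow.contDiffOn hflow.nonneg hψ))
    fun r _ x hx => by simp [image_eq_zero_of_notMem_tsupport hx]

lemma integrable_mul_comp [IsFiniteMeasureOnCompacts m] (hflow : IsContinuityFlow T m h b)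
    {g : ℝ → ℝ} (hg : ContinuousOn g (Ici 0)) (hχ : Continuous χ) (hχ' : HasCompactSupport χ)
    (ht : t ∈ Icc 0 T) : Integrable (fun x => χ x * g (h t x)) m :=
  (hχ.mul (hg.comp_continuous (continuous_slice hflow.contDiffOn ht)
    (hflow.nonneg t ht))).integrable_of_hasCompactSupport hχ'.mul_right

lemma integral_mul_mul_sub_primitive [IsFiniteMeasureOnCompacts m]
    (hflow : IsContinuityFlow T m h b) (hψ : ∀ y, 0 ≤ y → ContDiffAt ℝ 1 ψ y) (hχ : Continuous χ)
    (hχ' : HasCompactSupport χ) (ht : t ∈ Icc 0 T) :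
    ∫ x, χ x * (h t x * ψ (h t x) - ∫ z in 0..h t x, ψ z) ∂m =
      ∫ x, χ x * ψ (h t x) * h t x ∂m - ∫ x, χ x * (∫ z in 0..h t x, ψ z) ∂m := by
  have hM := hflow.integrable_mul_comp (continuousOn_mul_of_contDiffAt_nonneg hψ) hχ hχ' ht
  have hP := hflow.integrable_mul_comp (continuousOn_primitive hψ) hχ hχ' ht
  simp only [mul_assoc, mul_comm (ψ _)]
  rw [← integral_sub hM hP]
  simp only [mul_sub]

/- Fubini and the fundamental theorem of calculus in time at each point of space. -/
lemma integral_timeDeriv_part [IsFiniteMeasure m] (hflow : IsContinuityFlow T m h b)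
    (hψ : ∀ y, 0 ≤ y → ContDiffAt ℝ 1 ψ y) (hχ : Continuous χ) (hχ' : HasCompactSupport χ)
    (ht : t ∈ Icc 0 T) :
    ∫ q, χ q.2 * (h q.1 q.2 * deriv ψ (h q.1 q.2) * timeDeriv T h q.1 q.2) ∂spaceTime t m =
      ∫ x, χ x * (h t x * ψ (h t x) - ∫ z in 0..h t x, ψ z) ∂m
        - ∫ x, χ x * (h 0 x * ψ (h 0 x) - ∫ z in 0..h 0 x, ψ z) ∂m := by
  have hint := (hflow.integrable_timeDeriv_part hψ hχ hχ').mono_measure (spaceTime_mono ht.2)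
  have hΨ : ContinuousOn (fun u => u * ψ u - ∫ z in 0..u, ψ z) (Ici 0) :=
    (continuousOn_mul_of_contDiffAt_nonneg hψ).sub (continuousOn_primitive hψ)
  rw [integral_spaceTime_symm ht.1 hint, ← integral_sub
    (hflow.integrable_mul_comp hΨ hχ hχ' ht)
    (hflow.integrable_mul_comp hΨ hχ hχ' ⟨le_rfl, hflow.time_pos.le⟩)]
  refine integral_congr_ae (ae_of_all _ fun x => ?_)
  have hderiv : ∀ r ∈ Icc 0 T, HasDerivWithinAt
      (fun r => h r x * ψ (h r x) - ∫ z in 0..h r x, ψ z)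
      (h r x * deriv ψ (h r x) * timeDeriv T h r x) (Icc 0 T) r := fun r hr => by
    have hΨ := hasDerivAt_mul_sub_primitive hψ (hflow.nonneg r hr x)
    exact hΨ.comp_hasDerivWithinAt r (hasDerivWithinAt_timeDeriv hflow.contDiffOn hr x)
  have hcont : ContinuousOn (fun r => h r x * deriv ψ (h r x) * timeDeriv T h r x) (Icc 0 T) :=
    (continuousOn_mul_deriv_mul_timeDeriv hflow.time_pos hflow.contDiffOn hflow.nonneg hψ).comp
      (f := fun r => (r, x)) (by fun_prop) fun r hr => ⟨hr, trivial⟩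
  simp only [intervalIntegral.integral_const_mul, ← mul_sub]
  rw [integral_eq_sub_of_hasDerivWithinAt_Icc ht hderiv
    ((hcont.mono (Icc_subset_Icc_right ht.2)).intervalIntegrable_of_Icc ht.1)]

/- Testing with `φ = χ ψ(h)`, the terms containing `∂ₜ h` combine into an exact time derivative. -/
lemma integral_mul_primitive_sub [IsFiniteMeasure m] (hflow : IsContinuityFlow T m h b)
    (hψ : ∀ y, 0 ≤ y → ContDiffAt ℝ 1 ψ y) (hχ : ContDiff ℝ 1 χ) (hχ' : HasCompactSupport χ)
    (ht : t ∈ Icc 0 T) :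
    ∫ x, χ x * (∫ z in 0..h t x, ψ z) ∂m - ∫ x, χ x * (∫ z in 0..h 0 x, ψ z) ∂m =
      ∫ q, inner ℝ (gradient (fun x => χ x * ψ (h q.1 x)) q.2) (h q.1 q.2 • b q.1 q.2)
        ∂spaceTime t m := by
  have hφ := isTestFunction_mul_comp hflow.contDiffOn hflow.nonneg hψ hχ hχ'
  have hweak := hflow.weak_eq _ hφ t ht
  have hcongr : (fun q : ℝ × E =>
      χ q.2 * (h q.1 q.2 * deriv ψ (h q.1 q.2) * timeDeriv T h q.1 q.2)) =ᵐ[spaceTime t m]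
      fun q => timeDeriv T (fun t x => χ x * ψ (h t x)) q.1 q.2 * h q.1 q.2 :=
    ae_spaceTime_of_forall fun r hr x => by
      have hr' : r ∈ Icc 0 T := ⟨hr.1.le, hr.2.trans ht.2⟩
      simp only [timeDeriv_mul_comp hflow.time_pos hflow.contDiffOn hr'
        ((hψ _ (hflow.nonneg r hr' x)).differentiableAt one_ne_zero)]
      ring
  have hint := (hflow.integrable_timeDeriv_part hψ hχ.continuous hχ').mono_measure
    (spaceTime_mono ht.2)
  rw [integral_add (hint.congr hcongr)
    ((hφ.integrable_inner_gradient hflow.time_pos hflow.integrable_current).mono_measure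
      (spaceTime_mono ht.2)),
    ← integral_congr_ae hcongr, hflow.integral_timeDeriv_part hψ hχ.continuous hχ' ht,
    hflow.integral_mul_mul_sub_primitive hψ hχ.continuous hχ' ht,
    hflow.integral_mul_mul_sub_primitive hψ hχ.continuous hχ' ⟨le_rfl, hflow.time_pos.le⟩] at hweak
  linarith

end IsContinuityFlow

end Renormalization

section TruncatedEntropyIntegrals

variable {α : Type*} [MeasurableSpace α] {μ : Measure α} {u : α → ℝ}

lemma integrable_primitive_comp {ψ : ℝ → ℝ} {C : ℝ} (hψ : ∀ y, 0 ≤ y → ContDiffAt ℝ 1 ψ y)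
    (hψ_le : ∀ y, 0 ≤ y → |ψ y| ≤ C) (hu : Integrable u μ) (hu_nonneg : ∀ x, 0 ≤ u x) :
    Integrable (fun x => ∫ z in 0..u x, ψ z) μ := by
  have hcont : Continuous fun y : ℝ => ∫ z in 0..max y 0, ψ z :=
    (continuousOn_primitive hψ).comp_continuous (f := fun y => max y 0) (by fun_prop)
      fun y => le_max_right y 0
  have hmeas : AEStronglyMeasurable (fun x => ∫ z in 0..u x, ψ z) μ := by
    simpa only [max_eq_left (hu_nonneg _)] using hcont.comp_aestronglyMeasurable hu.1
  exact (hu.const_mul C).mono' hmeas (ae_of_all _ fun x => abs_primitive_le hψ_le (hu_nonneg x))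

lemma integrable_integral_truncLog {δ : ℝ} (hδ : δ ∈ Ioo 0 1) (hu : Integrable u μ)
    (hu_nonneg : ∀ x, 0 ≤ u x) : Integrable (fun x => ∫ z in 0..u x, truncLog δ z) μ :=
  integrable_primitive_comp (fun _ => contDiffAt_truncLog hδ.1)
    (fun _ => abs_truncLog_le hδ.1 hδ.2) hu hu_nonneg

variable [IsFiniteMeasure μ] {δ : ℕ → ℝ}

lemma tendsto_integral_integral_truncLog (hδ_mem : ∀ n, δ n ∈ Ioo 0 1)
    (hδ : Tendsto δ atTop (𝓝[>] 0)) (hu : Integrable u μ) (hu_nonneg : ∀ x, 0 ≤ u x)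
    (hlog : Integrable (fun x => u x * Real.log (u x)) μ) :
    Tendsto (fun n => ∫ x, (∫ z in 0..u x, truncLog (δ n) z) ∂μ) atTop
      (𝓝 (∫ x, u x * Real.log (u x) ∂μ - ∫ x, u x ∂μ)) := by
  rw [← integral_sub hlog hu]
  refine tendsto_integral_of_dominated_convergence (fun x => 1 + |u x * Real.log (u x)|)
    (fun n => (integrable_integral_truncLog (hδ_mem n) hu hu_nonneg).1)
    ((integrable_const 1).add hlog.abs) (fun n => ae_of_all _ fun x => ?_)
    (ae_of_all _ fun x => tendsto_integral_truncLog hδ (hu_nonneg x))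
  obtain ⟨hlb, hub⟩ := integral_truncLog_mem_Icc (hδ_mem n).1 (hδ_mem n).2 (hu_nonneg x)
  exact abs_le.2 ⟨by linarith [abs_nonneg (u x * Real.log (u x))], by linarith⟩

/- Fatou's lemma: the truncated entropies are bounded below by `-1`. -/
lemma integrable_mul_log_of_tendsto {A : ℝ} (hδ_mem : ∀ n, δ n ∈ Ioo 0 1)
    (hδ : Tendsto δ atTop (𝓝[>] 0)) (hu : Integrable u μ) (hu_nonneg : ∀ x, 0 ≤ u x)
    (hA : Tendsto (fun n => ∫ x, (∫ z in 0..u x, truncLog (δ n) z) ∂μ) atTop (𝓝 A)) :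
    Integrable (fun x => u x * Real.log (u x)) μ := by
  have hint := fun n => integrable_integral_truncLog (hδ_mem n) hu hu_nonneg
  have hlim : Integrable (fun x => u x * Real.log (u x) - u x + 1) μ := by
    refine integrable_of_tendsto_of_nonneg (A := A + ∫ _, 1 ∂μ)
      (fun n => (hint n).add (integrable_const 1))
      (fun n x => neg_le_iff_add_nonneg.1
        (integral_truncLog_mem_Icc (hδ_mem n).1 (hδ_mem n).2 (hu_nonneg x)).1)
      (fun x => (tendsto_integral_truncLog hδ (hu_nonneg x)).add_const 1) ?_
    simpa only [Pi.add_apply, integral_add (hint _) (integrable_const 1)] using hA.add_const _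
  exact ((hlim.sub (integrable_const 1)).add hu).congr (ae_of_all _ fun x => by simp)

end TruncatedEntropyIntegrals

section EntropyBalance

variable {E : Type*} [NormedAddCommGroup E] [InnerProductSpace ℝ E] [FiniteDimensional ℝ E]
  [MeasurableSpace E] {m : Measure E} {T t : ℝ} {h : ℝ → E → ℝ} {b : ℝ → E → E} {ψ : ℝ → ℝ}

lemma IsContinuityFlow.inner_gradient_cutoff_mul_comp (hflow : IsContinuityFlow T m h b)
    (hψ : ∀ y, 0 ≤ y → ContDiffAt ℝ 1 ψ y) (ht : t ∈ Icc 0 T) (n : ℕ) (x : E) :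
    inner ℝ (gradient (fun x => cutoff n x * ψ (h t x)) x) (h t x • b t x) =
      ψ (h t x) * inner ℝ (gradient (cutoff n) x) (h t x • b t x)
        + cutoff n x * (h t x * deriv ψ (h t x) * inner ℝ (gradient (h t) x) (b t x)) :=
  inner_gradient_mul_comp ((contDiff_cutoff n).differentiable one_ne_zero x)
    ((hψ _ (hflow.nonneg t ht x)).differentiableAt one_ne_zero)
    (hasFDerivAt_slice hflow.contDiffOn ht x).differentiableAt _

variable [BorelSpace E]

lemma tendsto_integral_cutoff_mul {g : E → ℝ} (hg : Integrable g m) :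
    Tendsto (fun n => ∫ x, cutoff n x * g x ∂m) atTop (𝓝 (∫ x, g x ∂m)) :=
  tendsto_integral_of_dominated_convergence (fun x => |g x|)
    (fun n => (contDiff_cutoff n).continuous.aestronglyMeasurable.mul hg.1) hg.abs
    (fun n => ae_of_all _ fun x => by
      simpa [abs_mul] using mul_le_of_le_one_left (abs_nonneg (g x)) (abs_cutoff_le_one n x))
    (ae_of_all _ fun x => by simpa using (tendsto_cutoff x).mul_const (g x))

namespace IsContinuityFlow

lemma tendsto_integral_flux_cutoff [IsFiniteMeasure m] (hflow : IsContinuityFlow T m h b)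
    {C C' : ℝ} (hψ : ∀ y, 0 ≤ y → ContDiffAt ℝ 1 ψ y) (hψ_le : ∀ y, 0 ≤ y → |ψ y| ≤ C)
    (hψ'_le : ∀ y, 0 ≤ y → |y * deriv ψ y| ≤ C')
    (hgb : Integrable (fun q : ℝ × E => inner ℝ (gradient (h q.1) q.2) (b q.1 q.2))
      (spaceTime T m)) (ht : t ∈ Icc 0 T) :
    Tendsto (fun n => ∫ q, inner ℝ (gradient (fun x => cutoff n x * ψ (h q.1 x)) q.2)
        (h q.1 q.2 • b q.1 q.2) ∂spaceTime t m) atTop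
      (𝓝 (∫ q, h q.1 q.2 * deriv ψ (h q.1 q.2) * inner ℝ (gradient (h q.1) q.2) (b q.1 q.2)
        ∂spaceTime t m)) := by
  obtain ⟨D, hD⟩ := exists_norm_gradient_cutoff_le (E := E)
  have hD' : ∀ (n : ℕ) (x v : E), |inner ℝ (gradient (cutoff n) x) v| ≤ D * ‖v‖ := fun n x v =>
    (abs_real_inner_le_norm _ _).trans (by gcongr; exact hD n x)
  have hmem : ∀ r ∈ Ioc 0 t, r ∈ Icc 0 T := fun r hr => ⟨hr.1.le, hr.2.trans ht.2⟩
  refine tendsto_integral_of_dominated_convergence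
    (fun q => C * (D * ‖h q.1 q.2 • b q.1 q.2‖)
      + C' * |inner ℝ (gradient (h q.1) q.2) (b q.1 q.2)|)
    (fun n => (((isTestFunction_mul_comp hflow.contDiffOn hflow.nonneg hψ (contDiff_cutoff n)
      (hasCompactSupport_cutoff n)).integrable_inner_gradient hflow.time_pos
        hflow.integrable_current).mono_measure (spaceTime_mono ht.2)).1)
    ((((hflow.integrable_current.norm.const_mul D).const_mul C).add
      (hgb.abs.const_mul C')).mono_measure (spaceTime_mono ht.2))
    (fun n => ae_spaceTime_of_forall fun r hr x => ?_)
    (ae_spaceTime_of_forall fun r hr x => ?_)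
  · have hy := hflow.nonneg r (hmem r hr) x
    rw [hflow.inner_gradient_cutoff_mul_comp hψ (hmem r hr)]
    refine (norm_add_le _ _).trans (add_le_add ?_ ?_)
    · rw [Real.norm_eq_abs, abs_mul]
      exact mul_le_mul (hψ_le _ hy) (hD' n x _) (abs_nonneg _) ((abs_nonneg _).trans (hψ_le _ hy))
    · rw [Real.norm_eq_abs, abs_mul, abs_mul]
      refine (mul_le_of_le_one_left (by positivity) (abs_cutoff_le_one n x)).trans ?_
      gcongr
      exact hψ'_le _ hy
  · simp only [hflow.inner_gradient_cutoff_mul_comp hψ (hmem r hr)]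
    have hgrad := ((tendsto_gradient_cutoff x).inner
      (tendsto_const_nhds (x := h r x • b r x))).const_mul (ψ (h r x))
    have hcutoff := (tendsto_cutoff x).mul_const
      (h r x * deriv ψ (h r x) * inner ℝ (gradient (h r) x) (b r x))
    simpa only [inner_zero_left, mul_zero, zero_add, one_mul] using hgrad.add hcutoff

lemma integral_primitive_sub [IsFiniteMeasure m] (hflow : IsContinuityFlow T m h b)
    {C C' : ℝ} (hψ : ∀ y, 0 ≤ y → ContDiffAt ℝ 1 ψ y) (hψ_le : ∀ y, 0 ≤ y → |ψ y| ≤ C)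
    (hψ'_le : ∀ y, 0 ≤ y → |y * deriv ψ y| ≤ C')
    (hgb : Integrable (fun q : ℝ × E => inner ℝ (gradient (h q.1) q.2) (b q.1 q.2))
      (spaceTime T m)) (ht : t ∈ Icc 0 T) :
    ∫ x, (∫ z in 0..h t x, ψ z) ∂m - ∫ x, (∫ z in 0..h 0 x, ψ z) ∂m =
      ∫ q, h q.1 q.2 * deriv ψ (h q.1 q.2) * inner ℝ (gradient (h q.1) q.2) (b q.1 q.2)
        ∂spaceTime t m := by
  have hlim : ∀ r ∈ Icc 0 T, Tendsto (fun n => ∫ x, cutoff n x * (∫ z in 0..h r x, ψ z) ∂m) atTop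
      (𝓝 (∫ x, (∫ z in 0..h r x, ψ z) ∂m)) := fun r hr => tendsto_integral_cutoff_mul
    (integrable_primitive_comp hψ hψ_le (hflow.integrable r hr) (hflow.nonneg r hr))
  refine tendsto_nhds_unique ((hlim t ht).sub (hlim 0 ⟨le_rfl, hflow.time_pos.le⟩)) ?_
  simp only [hflow.integral_mul_primitive_sub hψ (contDiff_cutoff _) (hasCompactSupport_cutoff _)
    ht]
  exact hflow.tendsto_integral_flux_cutoff hψ hψ_le hψ'_le hgb ht

/- Where `h` vanishes it is minimal, so `∇h` vanishes too. -/
lemma tendsto_integral_mul_deriv_truncLog_mul {δ : ℕ → ℝ} [IsFiniteMeasure m]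
    (hflow : IsContinuityFlow T m h b) (hδ_mem : ∀ n, δ n ∈ Ioo 0 1)
    (hδ : Tendsto δ atTop (𝓝[>] 0))
    (hgb : Integrable (fun q : ℝ × E => inner ℝ (gradient (h q.1) q.2) (b q.1 q.2))
      (spaceTime T m)) (ht : t ∈ Icc 0 T) :
    Tendsto (fun n => ∫ q, h q.1 q.2 * deriv (truncLog (δ n)) (h q.1 q.2)
        * inner ℝ (gradient (h q.1) q.2) (b q.1 q.2) ∂spaceTime t m) atTop
      (𝓝 (∫ q, inner ℝ (gradient (h q.1) q.2) (b q.1 q.2) ∂spaceTime t m)) := by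
  have hmem : ∀ r ∈ Ioc 0 t, r ∈ Icc 0 T := fun r hr => ⟨hr.1.le, hr.2.trans ht.2⟩
  have hgb' := hgb.mono_measure (spaceTime_mono ht.2)
  have hcont : ∀ n, ContinuousOn (fun q : ℝ × E =>
      h q.1 q.2 * deriv (truncLog (δ n)) (h q.1 q.2)) (Icc 0 t ×ˢ univ) := fun n =>
    ((continuousOn_id.mul (continuousOn_deriv_of_contDiffAt_nonneg
      fun _ => contDiffAt_truncLog (hδ_mem n).1)).comp hflow.contDiffOn.continuousOn
        fun q hq => hflow.nonneg q.1 hq.1 q.2).mono (prod_mono_left (Icc_subset_Icc_right ht.2))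
  refine tendsto_integral_of_dominated_convergence _
    (fun n => (aestronglyMeasurable_spaceTime_of_continuousOn (hcont n)).mul hgb'.1) hgb'.abs
    (fun n => ae_spaceTime_of_forall fun r hr x => ?_)
    (ae_spaceTime_of_forall fun r hr x => ?_)
  · rw [Real.norm_eq_abs, abs_mul]
    exact mul_le_of_le_one_left (abs_nonneg _)
      (abs_mul_deriv_truncLog_le (hδ_mem n).1 (hflow.nonneg r (hmem r hr) x))
  · rcases (hflow.nonneg r (hmem r hr) x).eq_or_lt with hzero | hpos
    · simp [gradient_eq_zero_of_nonneg (hflow.nonneg r (hmem r hr)) hzero.symm]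
    · simpa using (tendsto_mul_deriv_truncLog hδ hpos).mul_const
        (inner ℝ (gradient (h r) x) (b r x))

theorem entropy_balance [IsFiniteMeasure m] (hflow : IsContinuityFlow T m h b)
    (hgb : Integrable (fun q : ℝ × E => inner ℝ (gradient (h q.1) q.2) (b q.1 q.2))
      (spaceTime T m)) (hlog : Integrable (fun x => h 0 x * Real.log (h 0 x)) m)
    (ht : t ∈ Icc 0 T) :
    Integrable (fun x => h t x * Real.log (h t x)) m ∧
      ∫ x, h t x * Real.log (h t x) ∂m - ∫ x, h 0 x * Real.log (h 0 x) ∂m =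
        ∫ q, inner ℝ (gradient (h q.1) q.2) (b q.1 q.2) ∂spaceTime t m := by
  have h0 : (0 : ℝ) ∈ Icc 0 T := ⟨le_rfl, hflow.time_pos.le⟩
  obtain ⟨δ, -, hδ_mem, hδ₀⟩ := exists_seq_strictAnti_tendsto' (zero_lt_one (α := ℝ))
  have hδ : Tendsto δ atTop (𝓝[>] 0) :=
    tendsto_nhdsWithin_iff.2 ⟨hδ₀, Eventually.of_forall fun n => (hδ_mem n).1⟩
  have hentropy₀ := tendsto_integral_integral_truncLog hδ_mem hδ (hflow.integrable 0 h0)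
    (hflow.nonneg 0 h0) hlog
  have hrate := (hflow.tendsto_integral_mul_deriv_truncLog_mul hδ_mem hδ hgb ht).add hentropy₀
  simp only [← hflow.integral_primitive_sub (fun _ => contDiffAt_truncLog (hδ_mem _).1)
    (fun _ => abs_truncLog_le (hδ_mem _).1 (hδ_mem _).2)
    (fun _ => abs_mul_deriv_truncLog_le (hδ_mem _).1) hgb ht, sub_add_cancel] at hrate
  have hlog_t := integrable_mul_log_of_tendsto hδ_mem hδ (hflow.integrable t ht)
    (hflow.nonneg t ht) hrate
  have hentropy := tendsto_integral_integral_truncLog hδ_mem hδ (hflow.integrable t ht)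
    (hflow.nonneg t ht) hlog_t
  have heq := tendsto_nhds_unique hentropy hrate
  rw [hflow.integral_eq t ht] at heq
  exact ⟨hlog_t, by linarith⟩

end IsContinuityFlow

end EntropyBalance

section MeasurabilityInSpaceTime

variable {Ω F : Type*} [MeasurableSpace Ω] {μ : Measure Ω} {u : ℝ → Ω → F} {T : ℝ}
  [TopologicalSpace F] [TopologicalSpace.PseudoMetrizableSpace F] [MeasurableSpace F]
  [BorelSpace F]

/- Off a null set, `u` agrees on `[0, T]` with a process which is constant in time outside `[0, T]`
and therefore continuous in time everywhere. -/
lemma aemeasurable_spaceTime_of_ae_continuousOn [SFinite μ] (hT : 0 ≤ T)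
    (hu : ∀ t ∈ Icc 0 T, Measurable (u t))
    (hu_cont : ∀ᵐ ω ∂μ, ContinuousOn (fun t => u t ω) (Icc 0 T)) :
    AEMeasurable (fun q : ℝ × Ω => u q.1 q.2) (spaceTime T μ) := by
  classical
  obtain ⟨A, hA, hA_meas, hA_sub⟩ := hu_cont.exists_measurable_mem
  rcases isEmpty_or_nonempty Ω with hΩ | ⟨⟨ω₀⟩⟩
  · exact Measurable.aemeasurable (measurable_of_empty _)
  let v : ℝ → Ω → F := fun r ω => if ω ∈ A then u (projIcc 0 T hT r) ω else u 0 ω₀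
  have hv_cont : ∀ ω, Continuous fun r => v r ω := fun ω => by
    by_cases hω : ω ∈ A
    · simpa only [v, if_pos hω, Function.comp_def] using (hA_sub ω hω).comp_continuous
        (f := fun r => (projIcc 0 T hT r : ℝ)) (continuous_subtype_val.comp continuous_projIcc)
        fun r => (projIcc 0 T hT r).2
    · simpa only [v, if_neg hω] using continuous_const
  have hv : Measurable (Function.uncurry v) :=
    measurable_uncurry_of_continuous_of_measurable hv_cont fun r =>
      .ite hA_meas (hu _ (projIcc 0 T hT r).2) measurable_const
  refine ⟨Function.uncurry v, hv, ?_⟩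
  have hA_ae : ∀ᵐ q : ℝ × Ω ∂spaceTime T μ, q.2 ∈ A := Measure.quasiMeasurePreserving_snd.ae hA
  have hT_ae : ∀ᵐ q : ℝ × Ω ∂spaceTime T μ, q.1 ∈ Icc 0 T :=
    ae_spaceTime_of_forall fun r hr _ => Ioc_subset_Icc_self hr
  filter_upwards [hA_ae, hT_ae] with q hqA hqT
  simp only [Function.uncurry, v, if_pos hqA, projIcc_of_mem hT hqT]

end MeasurabilityInSpaceTime

section DensityOfLaw

variable {α β G : Type*} [MeasurableSpace α] [MeasurableSpace β] [NormedAddCommGroup G]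
  [NormedSpace ℝ G] {μ : Measure α} {ν : Measure β} {h : β → ℝ} {Y : α → β}

lemma integrable_withDensity_ofReal_iff (hh : AEMeasurable h ν) (hh_nonneg : 0 ≤ᵐ[ν] h)
    {F : β → G} :
    Integrable F (ν.withDensity fun x => ENNReal.ofReal (h x)) ↔
      Integrable (fun x => h x • F x) ν := by
  rw [integrable_withDensity_iff_integrable_smul₀' hh.ennreal_ofReal (by simp)]
  exact integrable_congr (hh_nonneg.mono fun x hx => by simp only [ENNReal.toReal_ofReal hx])

lemma integral_withDensity_ofReal (hh : AEMeasurable h ν) (hh_nonneg : 0 ≤ᵐ[ν] h) (F : β → G) :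
    ∫ x, F x ∂ν.withDensity (fun x => ENNReal.ofReal (h x)) = ∫ x, h x • F x ∂ν := by
  rw [integral_withDensity_eq_integral_toReal_smul₀ hh.ennreal_ofReal (by simp)]
  exact integral_congr_ae (hh_nonneg.mono fun x hx => by simp only [ENNReal.toReal_ofReal hx])

variable (hY : AEMeasurable Y μ) (hh : AEMeasurable h ν) (hh_nonneg : 0 ≤ᵐ[ν] h)
  (hlaw : μ.map Y = ν.withDensity fun x => ENNReal.ofReal (h x))

include hY hh hh_nonneg hlaw

lemma integrable_comp_iff_of_map_eq {F : β → G} (hF : AEStronglyMeasurable F ν) :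
    Integrable (fun a => F (Y a)) μ ↔ Integrable (fun x => h x • F x) ν := by
  have hF' : AEStronglyMeasurable F (μ.map Y) :=
    hlaw ▸ hF.mono_ac (withDensity_absolutelyContinuous _ _)
  rw [← integrable_withDensity_ofReal_iff hh hh_nonneg, ← hlaw, integrable_map_measure hF' hY]
  rfl

lemma integral_comp_of_map_eq {F : β → G} (hF : AEStronglyMeasurable F ν) :
    ∫ a, F (Y a) ∂μ = ∫ x, h x • F x ∂ν := by
  have hF' : AEStronglyMeasurable F (μ.map Y) :=
    hlaw ▸ hF.mono_ac (withDensity_absolutelyContinuous _ _)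
  rw [← integral_withDensity_ofReal hh hh_nonneg, ← hlaw, integral_map hY hF']

end DensityOfLaw

section LawOfFlow

variable {E Ω : Type*} [NormedAddCommGroup E] [InnerProductSpace ℝ E] [MeasurableSpace E]
  [MeasurableSpace Ω]

/-- The random curve `X` follows the velocity field `b` on `[0, T]` and its law at time `t` has the
density `h t` with respect to `m`, where `h` is nonnegative and `C¹`, and where `b` is measurable
and integrable against the space-time law. -/
structure IsFlowWithDensity (T : ℝ) (P : Measure Ω) (X : ℝ → Ω → E) (m : Measure E)
    (h : ℝ → E → ℝ) (b : ℝ → E → E) : Prop where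
  time_pos : 0 < T
  measurable : ∀ t ∈ Icc 0 T, Measurable (X t)
  hasDerivWithinAt : ∀ᵐ ω ∂P, ∀ t ∈ Icc 0 T,
    HasDerivWithinAt (fun τ => X τ ω) (b t (X t ω)) (Icc 0 T) t
  map_eq : ∀ t ∈ Icc 0 T, P.map (X t) = m.withDensity fun x => ENNReal.ofReal (h t x)
  nonneg : ∀ t ∈ Icc 0 T, ∀ x, 0 ≤ h t x
  contDiffOn : ContDiffOn ℝ 1 (Function.uncurry h) (Icc 0 T ×ˢ univ)
  aestronglyMeasurable_velocity :
    AEStronglyMeasurable (fun q : ℝ × E => b q.1 q.2) (spaceTime T m)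
  integrable_current : Integrable (fun q : ℝ × E => h q.1 q.2 • b q.1 q.2) (spaceTime T m)

namespace IsFlowWithDensity

variable {T t : ℝ} {P : Measure Ω} {X : ℝ → Ω → E} {m : Measure E} {h : ℝ → E → ℝ}
  {b : ℝ → E → E}

lemma spaceTime_density_nonneg [SFinite m] (hX : IsFlowWithDensity T P X m h b) (ht : t ≤ T) :
    ∀ᵐ q : ℝ × E ∂spaceTime t m, 0 ≤ h q.1 q.2 :=
  ae_spaceTime_of_forall fun r hr => hX.nonneg r ⟨hr.1.le, hr.2.trans ht⟩

variable [BorelSpace E]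

lemma aemeasurable_spaceTime [SFinite P] (hX : IsFlowWithDensity T P X m h b) (ht : t ≤ T) :
    AEMeasurable (fun q : ℝ × Ω => (q.1, X q.1 q.2)) (spaceTime t P) := by
  have hcont : ∀ᵐ ω ∂P, ContinuousOn (fun t => X t ω) (Icc 0 T) :=
    hX.hasDerivWithinAt.mono fun ω hω r hr => (hω r hr).continuousWithinAt
  exact measurable_fst.aemeasurable.prodMk
    ((aemeasurable_spaceTime_of_ae_continuousOn hX.time_pos.le hX.measurable hcont).mono_measure
      (spaceTime_mono ht))

lemma integral_comp (hX : IsFlowWithDensity T P X m h b) (ht : t ∈ Icc 0 T) {g : E → ℝ}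
    (hg : Continuous g) : ∫ ω, g (X t ω) ∂P = ∫ x, g x * h t x ∂m := by
  rw [integral_comp_of_map_eq (hX.measurable t ht).aemeasurable
    (continuous_slice hX.contDiffOn ht).aemeasurable (ae_of_all _ (hX.nonneg t ht)) (hX.map_eq t ht)
    hg.aestronglyMeasurable]
  simp only [smul_eq_mul, mul_comm]

lemma integrable_comp_iff (hX : IsFlowWithDensity T P X m h b) (ht : t ∈ Icc 0 T) {g : E → ℝ}
    (hg : Continuous g) :
    Integrable (fun ω => g (X t ω)) P ↔ Integrable (fun x => g x * h t x) m := by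
  rw [integrable_comp_iff_of_map_eq (hX.measurable t ht).aemeasurable
    (continuous_slice hX.contDiffOn ht).aemeasurable (ae_of_all _ (hX.nonneg t ht)) (hX.map_eq t ht)
    hg.aestronglyMeasurable]
  simp only [smul_eq_mul, mul_comm]

lemma integral_density (hX : IsFlowWithDensity T P X m h b) (ht : t ∈ Icc 0 T) :
    ∫ x, h t x ∂m = P.real univ := by
  simpa using (hX.integral_comp ht (continuous_const (y := (1 : ℝ)))).symm

lemma integrable_density [IsFiniteMeasure P] (hX : IsFlowWithDensity T P X m h b)
    (ht : t ∈ Icc 0 T) :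
    Integrable (h t) m := by
  simpa using (hX.integrable_comp_iff ht continuous_const).1 (integrable_const (1 : ℝ))

variable [FiniteDimensional ℝ E]

lemma aemeasurable_spaceTime_density [SFinite m] (hX : IsFlowWithDensity T P X m h b)
    (ht : t ≤ T) : AEMeasurable (fun q : ℝ × E => h q.1 q.2) (spaceTime t m) :=
  ((aestronglyMeasurable_spaceTime_of_continuousOn
    hX.contDiffOn.continuousOn).mono_measure (spaceTime_mono ht)).aemeasurable

lemma map_spaceTime_eq [SFinite P] [SFinite m] (hX : IsFlowWithDensity T P X m h b)
    (ht : t ≤ T) :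
    (spaceTime t P).map (fun q : ℝ × Ω => (q.1, X q.1 q.2)) =
      (spaceTime t m).withDensity fun q => ENNReal.ofReal (h q.1 q.2) := by
  refine Measure.ext_of_lintegral _ fun φ hφ => ?_
  have hY := hX.aemeasurable_spaceTime ht
  have hh := (hX.aemeasurable_spaceTime_density ht).ennreal_ofReal
  rw [lintegral_map' hφ.aemeasurable hY,
    lintegral_withDensity_eq_lintegral_mul₀ hh hφ.aemeasurable, spaceTime, spaceTime,
    lintegral_prod (fun q => φ (q.1, X q.1 q.2)) (hφ.comp_aemeasurable hY),
    lintegral_prod _ (hh.mul hφ.aemeasurable)]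
  refine setLIntegral_congr_fun measurableSet_Ioc fun r hr => ?_
  have hr' : r ∈ Icc 0 T := ⟨hr.1.le, hr.2.trans ht⟩
  have hφr : Measurable fun x => φ (r, x) := hφ.comp measurable_prodMk_left
  calc ∫⁻ ω, φ (r, X r ω) ∂P = ∫⁻ x, φ (r, x) ∂(P.map (X r)) :=
        (lintegral_map hφr (hX.measurable r hr')).symm
    _ = ∫⁻ x, ENNReal.ofReal (h r x) * φ (r, x) ∂m := by
        rw [hX.map_eq r hr', lintegral_withDensity_eq_lintegral_mul _
          (continuous_slice hX.contDiffOn hr').measurable.ennreal_ofReal hφr]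
        rfl

variable [IsFiniteMeasure m] {φ : ℝ → E → ℝ}

lemma aestronglyMeasurable_timeDeriv_add_inner_gradient (hX : IsFlowWithDensity T P X m h b)
    (hφ : IsTestFunction T φ) (ht : t ≤ T) :
    AEStronglyMeasurable
      (fun q : ℝ × E => timeDeriv T φ q.1 q.2 + inner ℝ (gradient (φ q.1) q.2) (b q.1 q.2))
      (spaceTime t m) :=
  ((aestronglyMeasurable_spaceTime_of_continuousOn
      (continuousOn_timeDeriv hX.time_pos hφ.contDiffOn)).add
    ((aestronglyMeasurable_spaceTime_of_continuousOn
      (continuousOn_gradient hX.time_pos hφ.contDiffOn)).inner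
        hX.aestronglyMeasurable_velocity)).mono_measure (spaceTime_mono ht)

lemma integrable_smul_timeDeriv_add_inner_gradient (hX : IsFlowWithDensity T P X m h b)
    (hφ : IsTestFunction T φ) (ht : t ≤ T) :
    Integrable (fun q : ℝ × E => h q.1 q.2 •
      (timeDeriv T φ q.1 q.2 + inner ℝ (gradient (φ q.1) q.2) (b q.1 q.2))) (spaceTime t m) := by
  have h_time := hφ.integrable_timeDeriv_mul (m := m) hX.time_pos hX.contDiffOn.continuousOn
  have h_space := hφ.integrable_inner_gradient hX.time_pos hX.integrable_current
  refine ((h_time.add h_space).mono_measure (spaceTime_mono ht)).congr (ae_of_all _ fun q => ?_)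
  simp only [Pi.add_apply, inner_smul_right, smul_eq_mul]
  ring

variable [IsFiniteMeasure P]

lemma integrable_timeDeriv_add_inner_gradient_comp (hX : IsFlowWithDensity T P X m h b)
    (hφ : IsTestFunction T φ) (ht : t ∈ Icc 0 T) :
    Integrable (fun q : ℝ × Ω => timeDeriv T φ q.1 (X q.1 q.2)
      + inner ℝ (gradient (φ q.1) (X q.1 q.2)) (b q.1 (X q.1 q.2))) (spaceTime t P) :=
  (integrable_comp_iff_of_map_eq (hX.aemeasurable_spaceTime ht.2)
    (hX.aemeasurable_spaceTime_density ht.2) (hX.spaceTime_density_nonneg ht.2)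
    (hX.map_spaceTime_eq ht.2) (hX.aestronglyMeasurable_timeDeriv_add_inner_gradient hφ ht.2)).2
    (hX.integrable_smul_timeDeriv_add_inner_gradient hφ ht.2)

/- Along almost every trajectory `t ↦ φ t (X t)` has derivative `∂ₜφ + ⟪∇φ, b⟫`. -/
lemma weak_eq (hX : IsFlowWithDensity T P X m h b) (hφ : IsTestFunction T φ) (ht : t ∈ Icc 0 T) :
    ∫ x, φ t x * h t x ∂m - ∫ x, φ 0 x * h 0 x ∂m =
      ∫ q, (timeDeriv T φ q.1 q.2 * h q.1 q.2
        + inner ℝ (gradient (φ q.1) q.2) (h q.1 q.2 • b q.1 q.2)) ∂spaceTime t m := by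
  have h0 : (0 : ℝ) ∈ Icc 0 T := ⟨le_rfl, hX.time_pos.le⟩
  have hcomp : ∀ r ∈ Icc 0 T, Integrable (fun ω => φ r (X r ω)) P := fun r hr =>
    (hX.integrable_comp_iff hr (continuous_slice hφ.contDiffOn hr)).2
      (hφ.integrable_mul hr (continuous_slice hX.contDiffOn hr))
  have hint := hX.integrable_timeDeriv_add_inner_gradient_comp hφ ht
  calc ∫ x, φ t x * h t x ∂m - ∫ x, φ 0 x * h 0 x ∂m
      = ∫ ω, (φ t (X t ω) - φ 0 (X 0 ω)) ∂P := by
        rw [integral_sub (hcomp t ht) (hcomp 0 h0),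
          hX.integral_comp ht (continuous_slice hφ.contDiffOn ht),
          hX.integral_comp h0 (continuous_slice hφ.contDiffOn h0)]
    _ = ∫ ω, (∫ r in 0..t, (timeDeriv T φ r (X r ω)
          + inner ℝ (gradient (φ r) (X r ω)) (b r (X r ω)))) ∂P := by
        refine integral_congr_ae ?_
        filter_upwards [hX.hasDerivWithinAt, hint.prod_left_ae] with ω hω hω_int
        exact (integral_timeDeriv_add_inner_gradient_curve hX.time_pos hφ.contDiffOn ht
          hω hω_int).symm
    _ = ∫ q, (timeDeriv T φ q.1 (X q.1 q.2)
          + inner ℝ (gradient (φ q.1) (X q.1 q.2)) (b q.1 (X q.1 q.2))) ∂spaceTime t P :=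
        (integral_spaceTime_symm ht.1 hint).symm
    _ = ∫ q, h q.1 q.2 • (timeDeriv T φ q.1 q.2
          + inner ℝ (gradient (φ q.1) q.2) (b q.1 q.2)) ∂spaceTime t m :=
        integral_comp_of_map_eq (hX.aemeasurable_spaceTime ht.2)
          (hX.aemeasurable_spaceTime_density ht.2) (hX.spaceTime_density_nonneg ht.2)
          (hX.map_spaceTime_eq ht.2)
          (hX.aestronglyMeasurable_timeDeriv_add_inner_gradient hφ ht.2)
    _ = _ := by
        congr with q
        simp only [inner_smul_right, smul_eq_mul]
        ring

theorem isContinuityFlow (hX : IsFlowWithDensity T P X m h b) : IsContinuityFlow T m h b where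
  time_pos := hX.time_pos
  nonneg := hX.nonneg
  contDiffOn := hX.contDiffOn
  integrable _ ht := hX.integrable_density ht
  integral_eq t ht := by
    rw [hX.integral_density ht, hX.integral_density ⟨le_rfl, hX.time_pos.le⟩]
  integrable_current := hX.integrable_current
  weak_eq _ hφ _ ht := hX.weak_eq hφ ht

end IsFlowWithDensity

end LawOfFlow

section LogGradient

variable {E : Type*} [NormedAddCommGroup E] [InnerProductSpace ℝ E] [CompleteSpace E]
  {φ : E → ℝ}

/-- The gradient of `log φ`, set to `0` on the zero set of `φ`. Unlike `gradient (log ∘ φ)`, it is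
a jointly measurable function of time and space when `φ` depends on time in a `C¹` way. -/
noncomputable def logGradient (φ : E → ℝ) (x : E) : E := (φ x)⁻¹ • gradient φ x

lemma smul_logGradient (hφ : ∀ y, 0 ≤ φ y) (x : E) : φ x • logGradient φ x = gradient φ x := by
  by_cases hx : φ x = 0
  · rw [hx, zero_smul, gradient_eq_zero_of_nonneg hφ hx]
  · rw [logGradient, smul_inv_smul₀ hx]

lemma norm_smul_le_logGradient (hφ : ∀ y, 0 ≤ φ y) (x v : E) :
    ‖φ x • v‖ ≤ φ x * (1 + ‖logGradient φ x‖ ^ 2 + ‖v + logGradient φ x‖ ^ 2) := by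
  have hv : ‖v‖ ≤ ‖v + logGradient φ x‖ + ‖logGradient φ x‖ := by
    simpa using norm_sub_le (v + logGradient φ x) (logGradient φ x)
  rw [norm_smul, Real.norm_of_nonneg (hφ x)]
  refine mul_le_mul_of_nonneg_left (hv.trans ?_) (hφ x)
  nlinarith [sq_nonneg (‖v + logGradient φ x‖ - 1 / 2), sq_nonneg (‖logGradient φ x‖ - 1 / 2)]

lemma abs_inner_gradient_le_logGradient (hφ : ∀ y, 0 ≤ φ y) (x v : E) :
    |inner ℝ (gradient φ x) v| ≤
      φ x * ((3 / 2) * ‖logGradient φ x‖ ^ 2 + (1 / 2) * ‖v + logGradient φ x‖ ^ 2) := by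
  set u := logGradient φ x with hu
  have hinner : inner ℝ u v = inner ℝ u (v + u) - ‖u‖ ^ 2 := by
    rw [inner_add_right, real_inner_self_eq_norm_sq, add_sub_cancel_right]
  rw [← smul_logGradient hφ, ← hu, real_inner_smul_left, abs_mul, abs_of_nonneg (hφ x), hinner]
  refine mul_le_mul_of_nonneg_left ?_ (hφ x)
  calc |inner ℝ u (v + u) - ‖u‖ ^ 2| ≤ |inner ℝ u (v + u)| + |‖u‖ ^ 2| := abs_sub _ _
    _ ≤ (1 / 2) * (‖u‖ ^ 2 + ‖v + u‖ ^ 2) + ‖u‖ ^ 2 := by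
        rw [abs_of_nonneg (sq_nonneg ‖u‖)]
        gcongr
        exact abs_inner_le_half_norm_sq_add _ _
    _ = (3 / 2) * ‖u‖ ^ 2 + (1 / 2) * ‖v + u‖ ^ 2 := by ring

end LogGradient

section EntropyDissipation

variable {E : Type*} [NormedAddCommGroup E] [InnerProductSpace ℝ E] [FiniteDimensional ℝ E]
  [MeasurableSpace E]

/-- The `C¹` curve of densities `h` and the velocity field `b` have finite mass `∫ h`, Fisher
information `∫ h ‖∇ log h‖²` and loss `∫ h ‖b + ∇ log h‖²` with respect to `m`, all three continuous
in time on `[0, T]`. If `b` is minus an approximation of `∇ log h`, then the loss measures its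
error. -/
structure HasContinuousRates (T : ℝ) (m : Measure E) (h : ℝ → E → ℝ) (b : ℝ → E → E) : Prop where
  time_pos : 0 < T
  nonneg : ∀ t ∈ Icc 0 T, ∀ x, 0 ≤ h t x
  contDiffOn : ContDiffOn ℝ 1 (Function.uncurry h) (Icc 0 T ×ˢ univ)
  measurable_velocity : ∀ t ∈ Icc 0 T, Measurable (b t)
  continuousOn_velocity : ∀ x, ContinuousOn (fun t => b t x) (Icc 0 T)
  integrable_density : ∀ t ∈ Icc 0 T, Integrable (h t) m
  continuousOn_mass : ContinuousOn (fun t => ∫ x, h t x ∂m) (Icc 0 T)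
  integrable_fisher : ∀ t ∈ Icc 0 T, Integrable (fun x => h t x * ‖logGradient (h t) x‖ ^ 2) m
  continuousOn_fisher :
    ContinuousOn (fun t => ∫ x, h t x * ‖logGradient (h t) x‖ ^ 2 ∂m) (Icc 0 T)
  integrable_loss : ∀ t ∈ Icc 0 T,
    Integrable (fun x => h t x * ‖b t x + logGradient (h t) x‖ ^ 2) m
  continuousOn_loss :
    ContinuousOn (fun t => ∫ x, h t x * ‖b t x + logGradient (h t) x‖ ^ 2 ∂m) (Icc 0 T)

namespace HasContinuousRates

variable {T t : ℝ} {m : Measure E} {h : ℝ → E → ℝ} {b : ℝ → E → E}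

lemma continuousOn_density_time (hr : HasContinuousRates T m h b) (x : E) :
    ContinuousOn (fun t => h t x) (Icc 0 T) :=
  hr.contDiffOn.continuousOn.comp (f := fun t => (t, x)) (by fun_prop) fun _ ht => ⟨ht, trivial⟩

lemma continuousOn_gradient_time (hr : HasContinuousRates T m h b) (x : E) :
    ContinuousOn (fun t => gradient (h t) x) (Icc 0 T) :=
  (continuousOn_gradient hr.time_pos hr.contDiffOn).comp (f := fun t => (t, x)) (by fun_prop)
    fun _ ht => ⟨ht, trivial⟩

lemma continuousWithinAt_logGradient (hr : HasContinuousRates T m h b) (ht : t ∈ Icc 0 T) {x : E}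
    (hx : h t x ≠ 0) : ContinuousWithinAt (fun r => logGradient (h r) x) (Icc 0 T) t :=
  ((hr.continuousOn_density_time x t ht).inv₀ hx).smul (hr.continuousOn_gradient_time x t ht)

lemma integrable_fisher_add_loss (hr : HasContinuousRates T m h b) (ht : t ∈ Icc 0 T) :
    Integrable (fun x => h t x * ((3 / 2) * ‖logGradient (h t) x‖ ^ 2
      + (1 / 2) * ‖b t x + logGradient (h t) x‖ ^ 2)) m := by
  simp only [mul_add, mul_left_comm (h t _)]
  exact ((hr.integrable_fisher t ht).const_mul _).add ((hr.integrable_loss t ht).const_mul _)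

lemma continuousOn_integral_fisher_add_loss (hr : HasContinuousRates T m h b) :
    ContinuousOn (fun t => ∫ x, h t x * ((3 / 2) * ‖logGradient (h t) x‖ ^ 2
      + (1 / 2) * ‖b t x + logGradient (h t) x‖ ^ 2) ∂m) (Icc 0 T) := by
  refine ((hr.continuousOn_fisher.const_mul (3 / 2)).add
    (hr.continuousOn_loss.const_mul (1 / 2))).congr fun t ht => ?_
  simp only [mul_add, mul_left_comm (h t _), Pi.add_apply]
  rw [integral_add ((hr.integrable_fisher t ht).const_mul _)
    ((hr.integrable_loss t ht).const_mul _), integral_const_mul, integral_const_mul]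

variable [BorelSpace E]

section SpaceTime

variable [SFinite m]

lemma aestronglyMeasurable_density (hr : HasContinuousRates T m h b) :
    AEStronglyMeasurable (fun q : ℝ × E => h q.1 q.2) (spaceTime T m) :=
  aestronglyMeasurable_spaceTime_of_continuousOn hr.contDiffOn.continuousOn

lemma aestronglyMeasurable_gradient (hr : HasContinuousRates T m h b) :
    AEStronglyMeasurable (fun q : ℝ × E => gradient (h q.1) q.2) (spaceTime T m) :=
  aestronglyMeasurable_spaceTime_of_continuousOn (continuousOn_gradient hr.time_pos hr.contDiffOn)

lemma aestronglyMeasurable_logGradient (hr : HasContinuousRates T m h b) :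
    AEStronglyMeasurable (fun q : ℝ × E => logGradient (h q.1) q.2) (spaceTime T m) :=
  (hr.aestronglyMeasurable_density.aemeasurable.inv.smul
    hr.aestronglyMeasurable_gradient.aemeasurable).aestronglyMeasurable

lemma aestronglyMeasurable_velocity (hr : HasContinuousRates T m h b) :
    AEStronglyMeasurable (fun q : ℝ × E => b q.1 q.2) (spaceTime T m) :=
  (aemeasurable_spaceTime_of_ae_continuousOn hr.time_pos.le hr.measurable_velocity
    (ae_of_all _ hr.continuousOn_velocity)).aestronglyMeasurable

lemma integrable_spaceTime_density (hr : HasContinuousRates T m h b) :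
    Integrable (fun q : ℝ × E => h q.1 q.2) (spaceTime T m) :=
  integrable_spaceTime_of_nonneg hr.aestronglyMeasurable_density
    (fun r hrT => hr.nonneg r (Ioc_subset_Icc_self hrT))
    (fun r hrT => hr.integrable_density r (Ioc_subset_Icc_self hrT)) hr.continuousOn_mass

lemma integrable_spaceTime_fisher (hr : HasContinuousRates T m h b) :
    Integrable (fun q : ℝ × E => h q.1 q.2 * ‖logGradient (h q.1) q.2‖ ^ 2) (spaceTime T m) :=
  integrable_spaceTime_of_nonneg
    (hr.aestronglyMeasurable_density.mul (hr.aestronglyMeasurable_logGradient.norm.pow 2))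
    (fun r hrT x => mul_nonneg (hr.nonneg r (Ioc_subset_Icc_self hrT) x) (sq_nonneg _))
    (fun r hrT => hr.integrable_fisher r (Ioc_subset_Icc_self hrT)) hr.continuousOn_fisher

lemma integrable_spaceTime_loss (hr : HasContinuousRates T m h b) :
    Integrable (fun q : ℝ × E => h q.1 q.2 * ‖b q.1 q.2 + logGradient (h q.1) q.2‖ ^ 2)
      (spaceTime T m) :=
  integrable_spaceTime_of_nonneg
    (hr.aestronglyMeasurable_density.mul
      ((hr.aestronglyMeasurable_velocity.add hr.aestronglyMeasurable_logGradient).norm.pow 2))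
    (fun r hrT x => mul_nonneg (hr.nonneg r (Ioc_subset_Icc_self hrT) x) (sq_nonneg _))
    (fun r hrT => hr.integrable_loss r (Ioc_subset_Icc_self hrT)) hr.continuousOn_loss

lemma integrable_spaceTime_current (hr : HasContinuousRates T m h b) :
    Integrable (fun q : ℝ × E => h q.1 q.2 • b q.1 q.2) (spaceTime T m) := by
  refine ((hr.integrable_spaceTime_density.add hr.integrable_spaceTime_fisher).add
    hr.integrable_spaceTime_loss).mono'
    (hr.aestronglyMeasurable_density.smul hr.aestronglyMeasurable_velocity)
    (ae_spaceTime_of_forall fun r hrT x => ?_)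
  have hle := norm_smul_le_logGradient (hr.nonneg r (Ioc_subset_Icc_self hrT)) x (b r x)
  simpa only [Pi.add_apply, mul_add, mul_one] using hle

lemma integrable_spaceTime_inner_gradient (hr : HasContinuousRates T m h b) :
    Integrable (fun q : ℝ × E => inner ℝ (gradient (h q.1) q.2) (b q.1 q.2)) (spaceTime T m) := by
  refine ((hr.integrable_spaceTime_fisher.const_mul (3 / 2)).add
    (hr.integrable_spaceTime_loss.const_mul (1 / 2))).mono'
    (hr.aestronglyMeasurable_gradient.inner hr.aestronglyMeasurable_velocity)
    (ae_spaceTime_of_forall fun r hrT x => ?_)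
  have hle := abs_inner_gradient_le_logGradient (hr.nonneg r (Ioc_subset_Icc_self hrT)) x (b r x)
  simpa only [Real.norm_eq_abs, Pi.add_apply, mul_add, mul_left_comm (h r x)] using hle

end SpaceTime

lemma integrable_inner_gradient (hr : HasContinuousRates T m h b) (ht : t ∈ Icc 0 T) :
    Integrable (fun x => inner ℝ (gradient (h t) x) (b t x)) m := by
  have hgrad : Continuous (gradient (h t)) :=
    (continuousOn_gradient hr.time_pos hr.contDiffOn).comp_continuous
      (f := fun x => (t, x)) (by fun_prop) fun x => ⟨ht, trivial⟩
  exact (hr.integrable_fisher_add_loss ht).mono'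
    (hgrad.aestronglyMeasurable.inner (hr.measurable_velocity t ht).aestronglyMeasurable)
    (ae_of_all _ fun x => abs_inner_gradient_le_logGradient (hr.nonneg t ht) x (b t x))

/- The integrand is dominated by a combination of the Fisher information and loss densities: this
bound depends on time, but its integral is continuous in time. -/
lemma continuousOn_integral_inner_gradient (hr : HasContinuousRates T m h b) :
    ContinuousOn (fun t => ∫ x, inner ℝ (gradient (h t) x) (b t x) ∂m) (Icc 0 T) := by
  rw [continuousOn_iff_continuous_domRestrict, continuous_iff_seqContinuous]
  intro τ t hτ
  have hτ' : Tendsto (fun n => (τ n : ℝ)) atTop (𝓝[Icc 0 T] t) :=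
    tendsto_nhdsWithin_iff.2
      ⟨(continuous_subtype_val.tendsto t).comp hτ, Eventually.of_forall fun n => (τ n).2⟩
  have hb_lim : ∀ x, Tendsto (fun n => b (τ n) x) atTop (𝓝 (b t x)) := fun x =>
    (hr.continuousOn_velocity x t t.2).tendsto.comp hτ'
  refine tendsto_integral_of_abs_le (fun n => hr.integrable_inner_gradient (τ n).2)
    (hr.integrable_inner_gradient t.2) (fun n => hr.integrable_fisher_add_loss (τ n).2)
    (hr.integrable_fisher_add_loss t.2)
    (fun n x => abs_inner_gradient_le_logGradient (hr.nonneg _ (τ n).2) x _)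
    (fun x => abs_inner_gradient_le_logGradient (hr.nonneg _ t.2) x _)
    (ae_of_all _ fun x _ =>
      ((hr.continuousOn_gradient_time x t t.2).tendsto.comp hτ').inner (hb_lim x))
    (ae_of_all _ fun x hGx => ?_)
    ((hr.continuousOn_integral_fisher_add_loss t t.2).tendsto.comp hτ')
  have hu_lim := (hr.continuousWithinAt_logGradient t.2 (left_ne_zero_of_mul hGx)).tendsto.comp hτ'
  exact ((hr.continuousOn_density_time x t t.2).tendsto.comp hτ').mul
    (((hu_lim.norm.pow 2).const_mul _).add ((((hb_lim x).add hu_lim).norm.pow 2).const_mul _))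

lemma hasDerivWithinAt_integral_rate [SFinite m] (hr : HasContinuousRates T m h b)
    (ht : t ∈ Icc 0 T) :
    HasDerivWithinAt
      (fun τ => ∫ q, inner ℝ (gradient (h q.1) q.2) (b q.1 q.2) ∂spaceTime τ m)
      (∫ x, inner ℝ (gradient (h t) x) (b t x) ∂m) (Icc 0 T) t := by
  have : Fact (t ∈ Icc 0 T) := ⟨ht⟩
  have hcont := hr.continuousOn_integral_inner_gradient
  have hderiv := intervalIntegral.integral_hasDerivWithinAt_right (s := Icc 0 T) (t := Icc 0 T)
    (a := 0) (b := t)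
    ((hcont.mono (Icc_subset_Icc_right ht.2)).intervalIntegrable_of_Icc ht.1)
    (hcont.stronglyMeasurableAtFilter_nhdsWithin measurableSet_Icc t) (hcont t ht)
  have hslice : ∀ τ ∈ Icc 0 T,
      ∫ q, inner ℝ (gradient (h q.1) q.2) (b q.1 q.2) ∂spaceTime τ m =
        ∫ r in 0..τ, ∫ x, inner ℝ (gradient (h r) x) (b r x) ∂m := fun τ hτ =>
    integral_spaceTime hτ.1
      (hr.integrable_spaceTime_inner_gradient.mono_measure (spaceTime_mono hτ.2))
  exact hderiv.congr hslice (hslice t ht)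

theorem hasDerivWithinAt_entropy [IsFiniteMeasure m] (hr : HasContinuousRates T m h b)
    (hflow : IsContinuityFlow T m h b)
    (hlog : Integrable (fun x => h 0 x * Real.log (h 0 x)) m) (ht : t ∈ Icc 0 T) :
    HasDerivWithinAt (fun τ => ∫ x, h τ x * Real.log (h τ x) ∂m)
      (∫ x, inner ℝ (gradient (h t) x) (b t x) ∂m) (Icc 0 T) t := by
  have hbalance : ∀ τ ∈ Icc 0 T, ∫ x, h τ x * Real.log (h τ x) ∂m =
      (∫ x, h 0 x * Real.log (h 0 x) ∂m) +
        ∫ q, inner ℝ (gradient (h q.1) q.2) (b q.1 q.2) ∂spaceTime τ m := fun τ hτ =>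
    (sub_eq_iff_eq_add'.1
      (hflow.entropy_balance hr.integrable_spaceTime_inner_gradient hlog hτ).2)
  exact ((hr.hasDerivWithinAt_integral_rate ht).const_add _).congr hbalance (hbalance t ht)

theorem isContinuityFlow_of_ode {Ω : Type*} [MeasurableSpace Ω] {P : Measure Ω}
    [IsFiniteMeasure P] [IsFiniteMeasure m] (hr : HasContinuousRates T m h b) {X : ℝ → Ω → E}
    (hX_meas : ∀ t ∈ Icc 0 T, Measurable (X t))
    (hX_ode : ∀ᵐ ω ∂P, ∀ t ∈ Icc 0 T,
      HasDerivWithinAt (fun τ => X τ ω) (b t (X t ω)) (Icc 0 T) t)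
    (hX_law : ∀ t ∈ Icc 0 T, P.map (X t) = m.withDensity fun x => ENNReal.ofReal (h t x)) :
    IsContinuityFlow T m h b :=
  IsFlowWithDensity.isContinuityFlow
    { time_pos := hr.time_pos
      measurable := hX_meas
      hasDerivWithinAt := hX_ode
      map_eq := hX_law
      nonneg := hr.nonneg
      contDiffOn := hr.contDiffOn
      aestronglyMeasurable_velocity := hr.aestronglyMeasurable_velocity
      integrable_current := hr.integrable_spaceTime_current }

end HasContinuousRates

end EntropyDissipation

section ChangeOfMeasure

variable {d : ℕ} {f π : EuclideanSpace ℝ (Fin d) → ℝ}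

lemma IsProbDensity.isProbabilityMeasure_densMeasure (hf : IsProbDensity f) :
    IsProbabilityMeasure (densMeasure f) :=
  ⟨by rw [densMeasure, withDensity_apply _ .univ, Measure.restrict_univ,
    ← ofReal_integral_eq_lintegral_ofReal hf.2.1 (ae_of_all _ hf.1), hf.2.2, ENNReal.ofReal_one]⟩

variable (hf : Measurable f) (hπ : Measurable π) (hπ_pos : ∀ x, 0 < π x)

include hf hπ hπ_pos

lemma densMeasure_eq_withDensity_div :
    densMeasure f = (densMeasure π).withDensity fun x => ENNReal.ofReal (f x / π x) := by
  have hdiv : Measurable fun x => f x / π x := hf.div hπ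
  rw [densMeasure, densMeasure, ← withDensity_mul _ hπ.ennreal_ofReal hdiv.ennreal_ofReal]
  congr with x
  rw [Pi.mul_apply, ← ENNReal.ofReal_mul (hπ_pos x).le, mul_div_cancel₀ _ (hπ_pos x).ne']

variable (hf_nonneg : ∀ x, 0 ≤ f x)

include hf_nonneg

lemma integrable_densMeasure_iff {F : EuclideanSpace ℝ (Fin d) → ℝ} :
    Integrable F (densMeasure f) ↔ Integrable (fun x => f x / π x * F x) (densMeasure π) := by
  rw [densMeasure_eq_withDensity_div hf hπ hπ_pos]
  exact integrable_withDensity_ofReal_iff (hf.div hπ).aemeasurable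
    (ae_of_all _ fun x => div_nonneg (hf_nonneg x) (hπ_pos x).le)

lemma integral_densMeasure (F : EuclideanSpace ℝ (Fin d) → ℝ) :
    ∫ x, F x ∂densMeasure f = ∫ x, f x / π x * F x ∂densMeasure π := by
  rw [densMeasure_eq_withDensity_div hf hπ hπ_pos]
  exact integral_withDensity_ofReal (hf.div hπ).aemeasurable
    (ae_of_all _ fun x => div_nonneg (hf_nonneg x) (hπ_pos x).le) F

end ChangeOfMeasure

section RelativeDensity

variable {d : ℕ} {f π : EuclideanSpace ℝ (Fin d) → ℝ}

section Pointwise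

variable {x : EuclideanSpace ℝ (Fin d)} (hf : DifferentiableAt ℝ f x)
  (hπ : DifferentiableAt ℝ π x) (hπx : π x ≠ 0)

include hf hπ hπx

lemma relScore_eq_score_sub_score (hfx : f x ≠ 0) : relScore f π x = score f x - score π x := by
  have hlog : (fun y => Real.log (f y / π y)) =ᶠ[𝓝 x]
      fun y => Real.log (f y) - Real.log (π y) := by
    filter_upwards [hf.continuousAt.eventually_ne hfx, hπ.continuousAt.eventually_ne hπx]
      with y hfy hπy using Real.log_div hfy hπy
  rw [relScore, score, score, gradient, gradient, gradient, hlog.fderiv_eq,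
    fderiv_fun_sub (hf.log hfx) (hπ.log hπx), map_sub]

lemma relScore_eq_logGradient (hfx : f x ≠ 0) :
    relScore f π x = logGradient (fun y => f y / π y) x := by
  have hdiv : DifferentiableAt ℝ (fun y => f y / π y) x := by
    simpa only [div_eq_mul_inv] using hf.fun_mul (hπ.fun_inv hπx)
  exact gradient_log hdiv (div_ne_zero hfx hπx)

lemma div_mul_norm_relScore_sq :
    f x / π x * ‖relScore f π x‖ ^ 2 =
      f x / π x * ‖logGradient (fun y => f y / π y) x‖ ^ 2 := by
  by_cases hfx : f x = 0
  · simp [hfx]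
  · rw [relScore_eq_logGradient hf hπ hπx hfx]

lemma div_mul_norm_sub_score_sq (v : EuclideanSpace ℝ (Fin d)) :
    f x / π x * ‖v - score f x‖ ^ 2 =
      f x / π x * ‖score π x - v + logGradient (fun y => f y / π y) x‖ ^ 2 := by
  by_cases hfx : f x = 0
  · simp [hfx]
  · have hcancel : score π x - v + relScore f π x = score f x - v := by
      rw [relScore_eq_score_sub_score hf hπ hπx hfx]
      abel
    rw [← relScore_eq_logGradient hf hπ hπx hfx, hcancel, norm_sub_rev]

end Pointwise

variable (hf : Differentiable ℝ f) (hπ : Differentiable ℝ π) (hπ_pos : ∀ x, 0 < π x)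
  (hf_nonneg : ∀ x, 0 ≤ f x)

include hf hπ hπ_pos hf_nonneg

lemma inner_gradient_div (x v : EuclideanSpace ℝ (Fin d)) :
    inner ℝ (gradient (fun y => f y / π y) x) (score π x - v) =
      f x / π x * (inner ℝ (score f x - v) (relScore f π x) - ‖relScore f π x‖ ^ 2) := by
  rw [← smul_logGradient (fun y => div_nonneg (hf_nonneg y) (hπ_pos y).le), real_inner_smul_left]
  by_cases hfx : f x = 0
  · simp [hfx]
  · have hsplit : score π x - v = score f x - v - relScore f π x := by
      rw [relScore_eq_score_sub_score (hf x) (hπ x) (hπ_pos x).ne' hfx]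
      abel
    rw [← relScore_eq_logGradient (hf x) (hπ x) (hπ_pos x).ne' hfx, hsplit, inner_sub_right,
      real_inner_self_eq_norm_sq, real_inner_comm]

lemma integrable_norm_relScore_sq_iff :
    Integrable (fun x => ‖relScore f π x‖ ^ 2) (densMeasure f) ↔
      Integrable (fun x => f x / π x * ‖logGradient (fun y => f y / π y) x‖ ^ 2)
        (densMeasure π) := by
  rw [integrable_densMeasure_iff hf.continuous.measurable hπ.continuous.measurable hπ_pos hf_nonneg]
  simp only [div_mul_norm_relScore_sq (hf _) (hπ _) (hπ_pos _).ne']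

lemma relFisher_eq_integral :
    relFisher f π =
      ∫ x, f x / π x * ‖logGradient (fun y => f y / π y) x‖ ^ 2 ∂densMeasure π := by
  rw [relFisher,
    integral_densMeasure hf.continuous.measurable hπ.continuous.measurable hπ_pos hf_nonneg]
  simp only [div_mul_norm_relScore_sq (hf _) (hπ _) (hπ_pos _).ne']

lemma integrable_norm_sub_score_sq_iff
    {s : EuclideanSpace ℝ (Fin d) → EuclideanSpace ℝ (Fin d)} :
    Integrable (fun x => ‖s x - score f x‖ ^ 2) (densMeasure f) ↔
      Integrable
        (fun x => f x / π x * ‖score π x - s x + logGradient (fun y => f y / π y) x‖ ^ 2)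
        (densMeasure π) := by
  rw [integrable_densMeasure_iff hf.continuous.measurable hπ.continuous.measurable hπ_pos hf_nonneg]
  simp only [div_mul_norm_sub_score_sq (hf _) (hπ _) (hπ_pos _).ne']

lemma scoreLoss_eq_integral (s : EuclideanSpace ℝ (Fin d) → EuclideanSpace ℝ (Fin d)) :
    scoreLoss s f =
      ∫ x, f x / π x * ‖score π x - s x + logGradient (fun y => f y / π y) x‖ ^ 2
        ∂densMeasure π := by
  rw [scoreLoss,
    integral_densMeasure hf.continuous.measurable hπ.continuous.measurable hπ_pos hf_nonneg]
  simp only [div_mul_norm_sub_score_sq (hf _) (hπ _) (hπ_pos _).ne']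

end RelativeDensity

section ScoreMatching

variable {d : ℕ} {f π : EuclideanSpace ℝ (Fin d) → ℝ}
  {s : EuclideanSpace ℝ (Fin d) → EuclideanSpace ℝ (Fin d)}

lemma measurable_gradient {E : Type*} [NormedAddCommGroup E] [InnerProductSpace ℝ E]
    [CompleteSpace E] [MeasurableSpace E] [BorelSpace E] (φ : E → ℝ) : Measurable (gradient φ) :=
  (InnerProductSpace.toDual ℝ E).symm.continuous.measurable.comp (measurable_fderiv ℝ φ)

variable (hs : Measurable s)
  (hF : Integrable (fun x => ‖relScore f π x‖ ^ 2) (densMeasure f))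
  (hL : Integrable (fun x => ‖s x - score f x‖ ^ 2) (densMeasure f))

include hs hF hL

lemma integrable_inner_relScore :
    Integrable (fun x => inner ℝ (score f x - s x) (relScore f π x)) (densMeasure f) :=
  integrable_inner_of_norm_sq ((measurable_gradient _).sub hs).aestronglyMeasurable
    (measurable_gradient _).aestronglyMeasurable (by simpa only [norm_sub_rev] using hL) hF

lemma integral_inner_relScore_le :
    ∫ x, inner ℝ (score f x - s x) (relScore f π x) ∂densMeasure f ≤
      (1 / 2) * (scoreLoss s f + relFisher f π) := by
  have hloss : scoreLoss s f = ∫ x, ‖score f x - s x‖ ^ 2 ∂densMeasure f := by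
    simp only [scoreLoss, norm_sub_rev]
  rw [hloss, relFisher]
  exact integral_inner_le_half_add (by simpa only [norm_sub_rev] using hL) hF
    (integrable_inner_relScore hs hF hL)

lemma integral_inner_gradient_div (hf : Differentiable ℝ f) (hπ : Differentiable ℝ π)
    (hπ_pos : ∀ x, 0 < π x) (hf_nonneg : ∀ x, 0 ≤ f x) :
    ∫ x, inner ℝ (gradient (fun y => f y / π y) x) (score π x - s x) ∂densMeasure π =
      (∫ x, inner ℝ (score f x - s x) (relScore f π x) ∂densMeasure f) - relFisher f π := by
  simp only [inner_gradient_div hf hπ hπ_pos hf_nonneg]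
  rw [relFisher, ← integral_sub (integrable_inner_relScore hs hF hL) hF,
    integral_densMeasure hf.continuous.measurable hπ.continuous.measurable hπ_pos hf_nonneg]

end ScoreMatching

lemma hasContinuousRates_div {d : ℕ} {T : ℝ} {π : EuclideanSpace ℝ (Fin d) → ℝ}
    {s : ℝ → EuclideanSpace ℝ (Fin d) → EuclideanSpace ℝ (Fin d)}
    {f : ℝ → EuclideanSpace ℝ (Fin d) → ℝ} (hT : 0 < T)
    (hπ_pos : ∀ x, 0 < π x) (hπ_smooth : ContDiff ℝ 1 π)
    (hs_meas : ∀ t ∈ Icc 0 T, Measurable (s t))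
    (hs_cont : ∀ x, ContinuousOn (fun t => s t x) (Icc 0 T))
    (hf_dens : ∀ t ∈ Icc 0 T, IsProbDensity (f t))
    (hf_smooth : ContDiffOn ℝ 1 (Function.uncurry f) (Icc 0 T ×ˢ univ))
    (hF_fin : ∀ t ∈ Icc 0 T, Integrable (fun x => ‖relScore (f t) π x‖ ^ 2) (densMeasure (f t)))
    (hF_cont : ContinuousOn (fun t => relFisher (f t) π) (Icc 0 T))
    (hL_fin : ∀ t ∈ Icc 0 T,
      Integrable (fun x => ‖s t x - score (f t) x‖ ^ 2) (densMeasure (f t)))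
    (hL_cont : ContinuousOn (fun t => scoreLoss (s t) (f t)) (Icc 0 T)) :
    HasContinuousRates T (densMeasure π) (fun t x => f t x / π x)
      (fun t x => score π x - s t x) := by
  have hπ : Differentiable ℝ π := hπ_smooth.differentiable one_ne_zero
  have hf : ∀ t ∈ Icc 0 T, Differentiable ℝ (f t) := fun t ht x =>
    (hasFDerivAt_slice hf_smooth ht x).differentiableAt
  have hprob : ∀ t ∈ Icc 0 T, IsProbabilityMeasure (densMeasure (f t)) := fun t ht =>
    (hf_dens t ht).isProbabilityMeasure_densMeasure
  have hmass : ∀ t ∈ Icc 0 T, ∫ x, f t x / π x ∂densMeasure π = 1 := fun t ht => by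
    have := hprob t ht
    simpa using (integral_densMeasure (hf t ht).continuous.measurable hπ.continuous.measurable
      hπ_pos (hf_dens t ht).1 fun _ => 1).symm
  exact
    { time_pos := hT
      nonneg := fun t ht x => div_nonneg ((hf_dens t ht).1 x) (hπ_pos x).le
      contDiffOn := hf_smooth.div (hπ_smooth.comp contDiff_snd).contDiffOn
        fun q _ => (hπ_pos q.2).ne'
      measurable_velocity := fun t ht => (measurable_gradient _).sub (hs_meas t ht)
      continuousOn_velocity := fun x => continuousOn_const.sub (hs_cont x)
      integrable_density := fun t ht => .of_integral_ne_zero (by simp [hmass t ht])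
      continuousOn_mass := continuousOn_const.congr hmass
      integrable_fisher := fun t ht =>
        (integrable_norm_relScore_sq_iff (hf t ht) hπ hπ_pos (hf_dens t ht).1).1 (hF_fin t ht)
      continuousOn_fisher := hF_cont.congr fun t ht =>
        (relFisher_eq_integral (hf t ht) hπ hπ_pos (hf_dens t ht).1).symm
      integrable_loss := fun t ht =>
        (integrable_norm_sub_score_sq_iff (hf t ht) hπ hπ_pos (hf_dens t ht).1).1 (hL_fin t ht)
      continuousOn_loss := hL_cont.congr fun t ht =>
        (scoreLoss_eq_integral (hf t ht) hπ hπ_pos (hf_dens t ht).1 (s t)).symm }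

end ScoreDynamics

open ScoreDynamics MeasureTheory Filter Topology Set in
theorem mainTheorem2
    {d : ℕ} {T : ℝ} (hT : 0 < T)
    -- the target density
    (π : EuclideanSpace ℝ (Fin d) → ℝ)
    (hπ_pos : ∀ x, 0 < π x) (hπ_dens : ScoreDynamics.IsProbDensity π) (hπ_smooth : ContDiff ℝ 1 π)
    -- the time-dependent vector field
    (s : ℝ → EuclideanSpace ℝ (Fin d) → EuclideanSpace ℝ (Fin d))
    (hs_meas : ∀ t ∈ Set.Icc 0 T, Measurable (s t))
    (hs_cont : ∀ x, ContinuousOn (fun t => s t x) (Set.Icc 0 T))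
    -- the random trajectories
    {Ω : Type*} [MeasurableSpace Ω] (P : MeasureTheory.Measure Ω)
    [MeasureTheory.IsProbabilityMeasure P]
    (X : ℝ → Ω → EuclideanSpace ℝ (Fin d))
    (hX_meas : ∀ t ∈ Set.Icc 0 T, Measurable (X t))
    (hX_ode : ∀ᵐ ω ∂P, ∀ t ∈ Set.Icc 0 T,
      HasDerivWithinAt (fun τ => X τ ω)
        (ScoreDynamics.score π (X t ω) - s t (X t ω)) (Set.Icc 0 T) t)
    -- the density of the law of `X t`
    (f : ℝ → EuclideanSpace ℝ (Fin d) → ℝ)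
    (hf_dens : ∀ t ∈ Set.Icc 0 T, ScoreDynamics.IsProbDensity (f t))
    (hf_law : ∀ t ∈ Set.Icc 0 T, P.map (X t) = ScoreDynamics.densMeasure (f t))
    (hf_smooth : ContDiffOn ℝ 1 (fun p : ℝ × EuclideanSpace ℝ (Fin d) => f p.1 p.2)
      (Set.Icc 0 T ×ˢ Set.univ))
    -- finite initial relative entropy
    (hKL : MeasureTheory.Integrable (fun x => Real.log (f 0 x / π x))
      (ScoreDynamics.densMeasure (f 0)))
    -- the Fisher information and the loss are finite and continuous in time
    (hF_fin : ∀ t ∈ Set.Icc 0 T, MeasureTheory.Integrable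
      (fun x => ‖ScoreDynamics.relScore (f t) π x‖ ^ 2) (ScoreDynamics.densMeasure (f t)))
    (hF_cont : ContinuousOn (fun t => ScoreDynamics.relFisher (f t) π) (Set.Icc 0 T))
    (hL_fin : ∀ t ∈ Set.Icc 0 T, MeasureTheory.Integrable
      (fun x => ‖s t x - ScoreDynamics.score (f t) x‖ ^ 2) (ScoreDynamics.densMeasure (f t)))
    (hL_cont : ContinuousOn (fun t => ScoreDynamics.scoreLoss (s t) (f t)) (Set.Icc 0 T)) :
    ∀ t ∈ Set.Icc 0 T,
      MeasureTheory.Integrable (fun x => Real.log (f t x / π x))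
        (ScoreDynamics.densMeasure (f t)) ∧
      MeasureTheory.Integrable
        (fun x => inner ℝ (ScoreDynamics.score (f t) x - s t x)
          (ScoreDynamics.relScore (f t) π x)) (ScoreDynamics.densMeasure (f t)) ∧
      ∃ D : ℝ,
        HasDerivWithinAt (fun τ => ScoreDynamics.relEntropy (f τ) π) D (Set.Icc 0 T) t ∧
        -D = ScoreDynamics.relFisher (f t) π
          - ∫ x, inner ℝ (ScoreDynamics.score (f t) x - s t x)
              (ScoreDynamics.relScore (f t) π x) ∂(ScoreDynamics.densMeasure (f t)) ∧
        -D ≥ (1 / 2) * ScoreDynamics.relFisher (f t) π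
          - (1 / 2) * ScoreDynamics.scoreLoss (s t) (f t) ∧
        (ScoreDynamics.scoreLoss (s t) (f t) ≤ (1 / 2) * ScoreDynamics.relFisher (f t) π →
          -D ≥ (1 / 4) * ScoreDynamics.relFisher (f t) π) := by
  have hπ : Differentiable ℝ π := hπ_smooth.differentiable one_ne_zero
  have hf t (ht : t ∈ Icc 0 T) : Differentiable ℝ (f t) := fun x =>
    (hasFDerivAt_slice hf_smooth ht x).differentiableAt
  have hπ_meas := hπ.continuous.measurable
  have hf_meas t (ht : t ∈ Icc 0 T) := (hf t ht).continuous.measurable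
  have hrates := hasContinuousRates_div hT hπ_pos hπ_smooth hs_meas hs_cont hf_dens hf_smooth
    hF_fin hF_cont hL_fin hL_cont
  have := hπ_dens.isProbabilityMeasure_densMeasure
  have hflow := hrates.isContinuityFlow_of_ode hX_meas hX_ode fun t ht =>
    (hf_law t ht).trans (densMeasure_eq_withDensity_div (hf_meas t ht) hπ_meas hπ_pos)
  have hlog t (ht : t ∈ Icc 0 T) := integrable_densMeasure_iff (hf_meas t ht) hπ_meas hπ_pos
    (hf_dens t ht).1 (F := fun x => Real.log (f t x / π x))
  have hlog_zero := (hlog 0 ⟨le_rfl, hT.le⟩).1 hKL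
  have hentropy t (ht : t ∈ Icc 0 T) := integral_densMeasure (hf_meas t ht) hπ_meas hπ_pos
    (hf_dens t ht).1 fun x => Real.log (f t x / π x)
  intro t ht
  have hderiv := (hrates.hasDerivWithinAt_entropy hflow hlog_zero ht).congr hentropy (hentropy t ht)
  have hrate := integral_inner_gradient_div (hs_meas t ht) (hF_fin t ht) (hL_fin t ht) (hf t ht) hπ
    hπ_pos (hf_dens t ht).1
  have hle := integral_inner_relScore_le (hs_meas t ht) (hF_fin t ht) (hL_fin t ht)
  have hlog_fin := (hflow.entropy_balance hrates.integrable_spaceTime_inner_gradient hlog_zero ht).1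
  refine ⟨(hlog t ht).2 hlog_fin, integrable_inner_relScore (hs_meas t ht) (hF_fin t ht)
    (hL_fin t ht), _, hderiv, ?_, ?_, fun hsmall => ?_⟩ <;> rw [hrate] <;> linarith
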